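/- Let $\mathcal W$ be a bicategory whose hom-categories are locally small, complete and cocomplete, and which is biclosed: for each $1$-cell $A\colon x\to y$ and each object $z$, the functors $A\otimes(-)\colon \mathcal W(z,x)\to\mathcal W(z,y)$ and $(-)\otimes A\colon\mathcal W(y,z)\to\mathcal W(x,z)$ given by composition with $A$ have right adjoints. A $\mathcal W$-category $\mathcal A$ has a set of objects, an extent $\epsilon a\in\mathcal W$ for each object $a$, hom-objects $\mathcal A(b,a)\in\mathcal W(\epsilon a,\epsilon b)$, and identity and composition $2$-cells $I_{\epsilon a}\to\mathcal A(a,a)$ and $\mathcal A(c,b)\otimes\mathcal A(b,a)\to\mathcal A(c,a)$ that are unital and associative. A $\mathcal W$-functor is an extent-preserving map on objects together with $2$-cells on hom-objects that respect identities and composition. A profunctor $M\colon\mathcal A\nrightarrow\mathcal B$ consists of $1$-cells $M(b,a)\in\mathcal W(\epsilon a,\epsilon b)$ with unital, associative and mutually compatible actions of $\mathcal A$ and $\mathcal B$; profunctor maps are families of $2$-cells compatible with the actions. For $\mathcal B$ small, profunctors $M\colon\mathcal A\nrightarrow\mathcal B$ and $N\colon\mathcal B\nrightarrow\mathcal D$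 have a tensor product $N\otimes_{\mathcal B}M\colon\mathcal A\nrightarrow\mathcal D$, with $(N\otimes_{\mathcal B}M)(d,a)$ the coequaliser of the two maps $\sum_{b,b'}N(d,b)\otimes\mathcal B(b,b')\otimes M(b',a)\rightrightarrows\sum_b N(d,b)\otimes M(b,a)$ given by the actions. Small $\mathcal W$-categories, profunctors and profunctor maps form a bicategory $\mathcal W\text{-}\mathbf{Mod}$, with composition $\otimes$ and identities $\mathcal A=\mathcal A(-,-)$. For $\mathcal W$-functors $F\colon\mathcal A\to\mathcal C$ and $G\colon\mathcal B\to\mathcal C$ there is a profunctor $\mathcal C(G,F)\colon\mathcal A\nrightarrow\mathcal B$ with components $\mathcal C(Gb,Fa)$; we write $\mu$ for the profunctor maps induced by composition in $\mathcal C$, and $F\colon\mathcal A\to\mathcal C(F,F)$ for the action of $F$ on homs. An object $C$ of $\mathcal C$ is identified with a functor into $\mathcal C$ from the $\mathcal W$-category with one object, of extent $\epsilon C$, and hom-object $I_{\epsilon C}$. A map $u\colon N\otimes_{\mathcal B}M\to L$ exhibits $M$ as $[N,L]$ if every $f\colon N\otimes_{\mathcal B}K\to L$ equals $u\circ(N\otimes_{\mathcal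 B}\bar f)$ for a unique $\bar f\colon K\to M$, and exhibits $N$ as $\langle M,L\rangle$ if every $f\colon K\otimes_{\mathcal B}M\to L$ equals $u\circ(\bar f\otimes_{\mathcal B}M)$ for a unique $\bar f\colon K\to N$. Let $F\colon\mathcal B\to\mathcal C$ and $Z\colon\mathcal A\to\mathcal C$ be $\mathcal W$-functors with $\mathcal A,\mathcal B$ small. For $\varphi\colon\mathcal A\nrightarrow\mathcal B$, a map $a\colon\varphi\to\mathcal C(F,Z)$ exhibits $Z$ as a $\varphi$-weighted colimit of $F$ if for each $C\in\mathcal C$ the map $$\varphi\otimes_{\mathcal A}\mathcal C(Z,C)\xrightarrow{a\otimes 1}\mathcal C(F,Z)\otimes_{\mathcal A}\mathcal C(Z,C)\xrightarrow{\mu}\mathcal C(F,C)$$ exhibits $\mathcal C(Z,C)$ as $[\varphi,\mathcal C(F,C)]$. For $\psi\colon\mathcal B\nrightarrow\mathcal A$, a map $b\colon\psi\to\mathcal C(Z,F)$ exhibits $Z$ as a $\psi$-weighted limit of $F$ if for each $C\in\mathcal C$ the map $$\mathcal C(C,Z)\otimes_{\mathcal A}\psi\xrightarrow{1\otimes b}\mathcal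 C(C,Z)\otimes_{\mathcal A}\mathcal C(Z,F)\xrightarrow{\mu}\mathcal C(C,F)$$ exhibits $\mathcal C(C,Z)$ as $\langle\psi,\mathcal C(C,F)\rangle$. **Theorem.** Let $\mathcal A,\mathcal B$ be small $\mathcal W$-categories, let $\mathcal C$ be a (possibly large) $\mathcal W$-category, let $\varphi\colon\mathcal A\nrightarrow\mathcal B$ have the right adjoint $\psi\colon\mathcal B\nrightarrow\mathcal A$ in $\mathcal W\text{-}\mathbf{Mod}$, with unit $\eta\colon\mathcal A\to\psi\otimes_{\mathcal B}\varphi$ and counit $\varepsilon\colon\varphi\otimes_{\mathcal A}\psi\to\mathcal B$, and let $F\colon\mathcal B\to\mathcal C$ and $Z\colon\mathcal A\to\mathcal C$ be $\mathcal W$-functors. Then data of the following three forms are in bijective correspondence: (a) maps $a\colon\varphi\to\mathcal C(F,Z)$ exhibiting $Z$ as a $\varphi$-weighted colimit of $F$; (b) maps $b\colon\psi\to\mathcal C(Z,F)$ exhibiting $Z$ as a $\psi$-weighted limit of $F$; (c) pairs of maps $a\colon\varphi\to\mathcal C(F,Z)$ and $b\colon\psi\to\mathcal C(Z,F)$ such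 that $$\mu\circ(b\otimes_{\mathcal B}a)\circ\eta=Z\colon\mathcal A\to\mathcal C(Z,Z)\qquad\text{and}\qquad \mu\circ(a\otimes_{\mathcal A}b)=F\circ\varepsilon\colon\varphi\otimes_{\mathcal A}\psi\to\mathcal C(F,F).$$ More precisely, the projections $(a,b)\mapsto a$ and $(a,b)\mapsto b$ are bijections from the data (c) onto the data (a) and onto the data (b), respectively. -/

import Mathlib

open CategoryTheory Bicategory Limits

universe w v u u₁ u₂

/-- A bicategory whose homs are complete and cocomplete (locally small) categories, and which is
biclosed: both composition functors with a fixed 1-cell have right adjoints. Here "small" refers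
to the universe of the 2-cells. -/
class BiclosedBicategory (W : Type u) [Bicategory.{w, v} W] : Prop where
  complete : ∀ x y : W, HasLimits (x ⟶ y)
  cocomplete : ∀ x y : W, HasColimits (x ⟶ y)
  postcomp_isLeftAdjoint : ∀ {x y : W} (f : x ⟶ y) (z : W), (postcomp z f).IsLeftAdjoint
  precomp_isLeftAdjoint : ∀ {x y : W} (f : x ⟶ y) (z : W), (precomp z f).IsLeftAdjoint

attribute [instance] BiclosedBicategory.complete BiclosedBicategory.cocomplete
  BiclosedBicategory.postcomp_isLeftAdjoint BiclosedBicategory.precomp_isLeftAdjoint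

/-- A category enriched in the bicategory `W`. The 1-cell `hom a b : ext a ⟶ ext b` is the
hom-object usually written `A(b, a)`; composition of 1-cells is in diagrammatic order. -/
structure WCat (W : Type u) [Bicategory.{w, v} W] where
  ob : Type u₁
  ext : ob → W
  hom : ∀ a b, ext a ⟶ ext b
  id : ∀ a, 𝟙 (ext a) ⟶ hom a a
  comp : ∀ a b c, hom a b ≫ hom b c ⟶ hom a c
  id_comp : ∀ a b, id a ▷ hom a b ≫ comp a a b = (λ_ (hom a b)).hom
  comp_id : ∀ a b, hom a b ◁ id b ≫ comp a b b = (ρ_ (hom a b)).hom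
  assoc : ∀ a b c d, comp a b c ▷ hom c d ≫ comp a c d =
    (α_ (hom a b) (hom b c) (hom c d)).hom ≫ hom a b ◁ comp b c d ≫ comp a b d

/-- Small `W`-categories: the objects of the bicategory of modules. -/
abbrev WMod (W : Type u) [Bicategory.{w, v} W] := WCat.{w, v, u, w} W

/-- A profunctor `A ⇸ B` between small `W`-categories, with its actions of `A` and `B`.
The 1-cell `obj a b : ext a ⟶ ext b` is the component usually written `M(b, a)`. -/
structure WProf {W : Type u} [Bicategory.{w, v} W] (A B : WMod W) where
  obj : ∀ (a : A.ob) (b : B.ob), A.ext a ⟶ B.ext b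
  lact : ∀ a a' b, A.hom a a' ≫ obj a' b ⟶ obj a b
  ract : ∀ a b b', obj a b ≫ B.hom b b' ⟶ obj a b'
  id_lact : ∀ a b, A.id a ▷ obj a b ≫ lact a a b = (λ_ (obj a b)).hom
  comp_lact : ∀ a a' a'' b, A.comp a a' a'' ▷ obj a'' b ≫ lact a a'' b =
    (α_ (A.hom a a') (A.hom a' a'') (obj a'' b)).hom ≫ A.hom a a' ◁ lact a' a'' b ≫ lact a a' b
  ract_id : ∀ a b, obj a b ◁ B.id b ≫ ract a b b = (ρ_ (obj a b)).hom
  ract_ract : ∀ a b b' b'', ract a b b' ▷ B.hom b' b'' ≫ ract a b' b'' =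
    (α_ (obj a b) (B.hom b b') (B.hom b' b'')).hom ≫ obj a b ◁ B.comp b b' b'' ≫ ract a b b''
  lact_ract : ∀ a a' b b', lact a a' b ▷ B.hom b b' ≫ ract a b b' =
    (α_ (A.hom a a') (obj a' b) (B.hom b b')).hom ≫ A.hom a a' ◁ ract a' b b' ≫ lact a a' b'

/-- Maps of profunctors. -/
@[ext]
structure WProfHom {W : Type u} [Bicategory.{w, v} W] {A B : WMod W} (M N : WProf A B) where
  app : ∀ a b, M.obj a b ⟶ N.obj a b
  lact_app : ∀ a a' b, M.lact a a' b ≫ app a b = A.hom a a' ◁ app a' b ≫ N.lact a a' b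
  ract_app : ∀ a b b', M.ract a b b' ≫ app a b' = app a b ▷ B.hom b b' ≫ N.ract a b b'

section JointEpi

variable {D : Type u₁} [Category.{w} D] {D' : Type u₂} [Category.{w} D']

/-- A jointly epimorphic family of morphisms. -/
def JointEpi {I : Type w} {X : I → D} {S : D} (f : ∀ i, X i ⟶ S) : Prop :=
  ∀ ⦃T : D⦄ (g h : S ⟶ T), (∀ i, f i ≫ g = f i ≫ h) → g = h

theorem JointEpi.map {I : Type w} {X : I → D} {S : D} {f : ∀ i, X i ⟶ S} (hf : JointEpi f)
    (L : D ⥤ D') [L.IsLeftAdjoint] : JointEpi (fun i => L.map (f i)) := by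
  intro T g h H
  apply ((Adjunction.ofIsLeftAdjoint L).homEquiv _ _).injective
  apply hf
  intro i
  rw [← Adjunction.homEquiv_naturality_left, ← Adjunction.homEquiv_naturality_left, H i]

variable [HasColimits D] {I J : Type w} {X : I → D} {Y : J → D} {s t : J → I}
  (p : ∀ j, Y j ⟶ X (s j)) (q : ∀ j, Y j ⟶ X (t j))

/-- The coequaliser of the two maps `∐ Y ⇉ ∐ X` with components `p j` and `q j`. -/
noncomputable def sumCoeq : D :=
  coequalizer (Sigma.desc fun j => p j ≫ Sigma.ι X (s j)) (Sigma.desc fun j => q j ≫ Sigma.ι X (t j))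

/-- The coprojections into `sumCoeq`. -/
noncomputable def sumCoeqι (i : I) : X i ⟶ sumCoeq p q :=
  Sigma.ι X i ≫ coequalizer.π (Sigma.desc fun j => p j ≫ Sigma.ι X (s j))
    (Sigma.desc fun j => q j ≫ Sigma.ι X (t j))

theorem sumCoeq_condition (j : J) : p j ≫ sumCoeqι p q (s j) = q j ≫ sumCoeqι p q (t j) := by
  have h := Sigma.ι Y j ≫= coequalizer.condition (Sigma.desc fun j => p j ≫ Sigma.ι X (s j))
    (Sigma.desc fun j => q j ≫ Sigma.ι X (t j))
  rw [← Category.assoc, ← Category.assoc, Sigma.ι_desc, Sigma.ι_desc, Category.assoc,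
    Category.assoc] at h
  exact h

theorem sumCoeqι_jointEpi : JointEpi (sumCoeqι p q) := by
  intro T g h H
  refine coequalizer.hom_ext (Sigma.hom_ext _ _ fun i => ?_)
  have := H i
  unfold sumCoeqι at this
  erw [Category.assoc, Category.assoc] at this
  exact this

theorem sumCoeq_desc' {T : D} (f : ∀ i, X i ⟶ T) (hf : ∀ j, p j ≫ f (s j) = q j ≫ f (t j)) :
    ∃ g : sumCoeq p q ⟶ T, ∀ i, sumCoeqι p q i ≫ g = f i := by
  refine ⟨coequalizer.desc (Sigma.desc f) (Sigma.hom_ext _ _ fun j => ?_), fun i => ?_⟩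
  · rw [← Category.assoc, ← Category.assoc, Sigma.ι_desc, Sigma.ι_desc, Category.assoc,
      Category.assoc, Sigma.ι_desc, Sigma.ι_desc, hf]
  · unfold sumCoeqι
    erw [Category.assoc, coequalizer.π_desc, Sigma.ι_desc]

/-- Left adjoints preserve the universal property of `sumCoeq`. -/
theorem sumCoeq_desc (L : D ⥤ D') [L.IsLeftAdjoint] {T : D'} (f : ∀ i, L.obj (X i) ⟶ T)
    (hf : ∀ j, L.map (p j) ≫ f (s j) = L.map (q j) ≫ f (t j)) :
    ∃ g : L.obj (sumCoeq p q) ⟶ T, ∀ i, L.map (sumCoeqι p q i) ≫ g = f i := by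
  let adj := Adjunction.ofIsLeftAdjoint L
  obtain ⟨g, hg⟩ := sumCoeq_desc' p q (fun i => adj.homEquiv _ _ (f i)) (fun j => by
    rw [← Adjunction.homEquiv_naturality_left, ← Adjunction.homEquiv_naturality_left, hf])
  refine ⟨(adj.homEquiv _ _).symm g, fun i => ?_⟩
  rw [← Adjunction.homEquiv_naturality_left_symm, hg, Equiv.symm_apply_apply]

end JointEpi

namespace WProf

variable {W : Type u} [Bicategory.{w, v} W]

instance category (A B : WMod W) : Category.{w} (WProf A B) where
  Hom := WProfHom
  id M :=
    { app := fun a b => 𝟙 _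
      lact_app := by intros; simp
      ract_app := by intros; simp }
  comp {M N P} f g :=
    { app := fun a b => f.app a b ≫ g.app a b
      lact_app := by
        intro a a' b
        rw [← Category.assoc, f.lact_app, Category.assoc, g.lact_app, whiskerLeft_comp,
          Category.assoc]
      ract_app := by
        intro a b b'
        rw [← Category.assoc, f.ract_app, Category.assoc, g.ract_app, comp_whiskerRight,
          Category.assoc] }

@[ext]
theorem hom_ext {A B : WMod W} {M N : WProf A B} {f g : M ⟶ N}
    (h : ∀ a b, f.app a b = g.app a b) : f = g :=
  WProfHom.ext (funext fun a => funext fun b => h a b)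

@[simp]
theorem id_app {A B : WMod W} (M : WProf A B) (a b) : WProfHom.app (𝟙 M) a b = 𝟙 (M.obj a b) :=
  rfl

@[simp]
theorem comp_app {A B : WMod W} {M N P : WProf A B} (f : M ⟶ N) (g : N ⟶ P) (a b) :
    WProfHom.app (f ≫ g) a b = f.app a b ≫ g.app a b := rfl

/-- The identity profunctor, given by the hom-objects. -/
abbrev idProf (A : WMod W) : WProf A A where
  obj := A.hom
  lact := A.comp
  ract := A.comp
  id_lact := A.id_comp
  comp_lact := A.assoc
  ract_id := A.comp_id
  ract_ract := A.assoc
  lact_ract := A.assoc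

theorem whisker_assoc_symm_aux {x y z t : W} {X : x ⟶ y} {P Q : y ⟶ z} (f : P ⟶ Q) {Y : z ⟶ t}
    {T : x ⟶ t} (g : (X ≫ Q) ≫ Y ⟶ T) :
    (α_ X P Y).inv ≫ (X ◁ f) ▷ Y ≫ g = X ◁ f ▷ Y ≫ (α_ X Q Y).inv ≫ g := by simp

variable [BiclosedBicategory W] {A B C D E : WMod W}

section Tensor

variable (M : WProf A B) (N : WProf B C)

/-- The component of the tensor product over `B` of `M` and `N`: the coequaliser of the two maps
`∑ M a b ≫ B b b' ≫ N b' c ⇉ ∑ M a b ≫ N b c` given by the actions of `B` on `N` and on `M`. -/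
noncomputable def tensorObj (a : A.ob) (c : C.ob) : A.ext a ⟶ C.ext c :=
  sumCoeq (I := B.ob) (J := B.ob × B.ob) (X := fun b => M.obj a b ≫ N.obj b c)
    (Y := fun j => M.obj a j.1 ≫ B.hom j.1 j.2 ≫ N.obj j.2 c) (s := Prod.fst) (t := Prod.snd)
    (fun j => M.obj a j.1 ◁ N.lact j.1 j.2 c)
    (fun j => (α_ _ _ _).inv ≫ M.ract a j.1 j.2 ▷ N.obj j.2 c)

/-- The universal balanced family. -/
noncomputable def tι (a : A.ob) (b : B.ob) (c : C.ob) :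
    M.obj a b ≫ N.obj b c ⟶ tensorObj M N a c :=
  sumCoeqι (I := B.ob) (J := B.ob × B.ob) (X := fun b => M.obj a b ≫ N.obj b c)
    (Y := fun j => M.obj a j.1 ≫ B.hom j.1 j.2 ≫ N.obj j.2 c) (s := Prod.fst) (t := Prod.snd) _ _ b

theorem tι_balanced (a : A.ob) (b b' : B.ob) (c : C.ob) :
    M.ract a b b' ▷ N.obj b' c ≫ tι M N a b' c =
      (α_ _ _ _).hom ≫ M.obj a b ◁ N.lact b b' c ≫ tι M N a b c := by
  rw [← Iso.inv_comp_eq, ← Category.assoc]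
  exact (sumCoeq_condition (I := B.ob) (J := B.ob × B.ob) (X := fun b => M.obj a b ≫ N.obj b c)
    (Y := fun j => M.obj a j.1 ≫ B.hom j.1 j.2 ≫ N.obj j.2 c) (s := Prod.fst) (t := Prod.snd)
    (fun j => M.obj a j.1 ◁ N.lact j.1 j.2 c)
    (fun j => (α_ _ _ _).inv ≫ M.ract a j.1 j.2 ▷ N.obj j.2 c) (b, b')).symm

theorem tι_jointEpi (a : A.ob) (c : C.ob) : JointEpi fun b => tι M N a b c :=
  sumCoeqι_jointEpi _ _

theorem tensor_desc {D : Type v} [Category.{w} D] (a : A.ob) (c : C.ob)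
    (L : (A.ext a ⟶ C.ext c) ⥤ D) [L.IsLeftAdjoint] {T : D}
    (f : ∀ b, L.obj (M.obj a b ≫ N.obj b c) ⟶ T)
    (hf : ∀ b b', L.map (M.ract a b b' ▷ N.obj b' c) ≫ f b' =
      L.map (α_ _ _ _).hom ≫ L.map (M.obj a b ◁ N.lact b b' c) ≫ f b) :
    ∃ g : L.obj (tensorObj M N a c) ⟶ T, ∀ b, L.map (tι M N a b c) ≫ g = f b := by
  refine sumCoeq_desc (I := B.ob) (J := B.ob × B.ob) (X := fun b => M.obj a b ≫ N.obj b c)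
    (Y := fun j => M.obj a j.1 ≫ B.hom j.1 j.2 ≫ N.obj j.2 c) (s := Prod.fst) (t := Prod.snd)
    _ _ L f (fun j => ?_)
  rw [L.map_comp, Category.assoc, hf, ← Category.assoc, ← L.map_comp, Iso.inv_hom_id, L.map_id,
    Category.id_comp]

theorem exists_tdesc {a : A.ob} {c : C.ob} {T : A.ext a ⟶ C.ext c}
    (f : ∀ b, M.obj a b ≫ N.obj b c ⟶ T)
    (hf : ∀ b b', M.ract a b b' ▷ N.obj b' c ≫ f b' =
      (α_ _ _ _).hom ≫ M.obj a b ◁ N.lact b b' c ≫ f b) :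
    ∃ g : tensorObj M N a c ⟶ T, ∀ b, tι M N a b c ≫ g = f b :=
  tensor_desc M N a c (𝟭 _) f hf

theorem exists_tdescL {a : A.ob} {c : C.ob} {x : W} (X : x ⟶ A.ext a) {T : x ⟶ C.ext c}
    (f : ∀ b, X ≫ M.obj a b ≫ N.obj b c ⟶ T)
    (hf : ∀ b b', X ◁ M.ract a b b' ▷ N.obj b' c ≫ f b' =
      X ◁ (α_ _ _ _).hom ≫ X ◁ M.obj a b ◁ N.lact b b' c ≫ f b) :
    ∃ g : X ≫ tensorObj M N a c ⟶ T, ∀ b, X ◁ tι M N a b c ≫ g = f b :=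
  tensor_desc M N a c (precomp _ X) f hf

theorem exists_tdescR {a : A.ob} {c : C.ob} {y : W} (Y : C.ext c ⟶ y) {T : A.ext a ⟶ y}
    (f : ∀ b, (M.obj a b ≫ N.obj b c) ≫ Y ⟶ T)
    (hf : ∀ b b', M.ract a b b' ▷ N.obj b' c ▷ Y ≫ f b' =
      (α_ _ _ _).hom ▷ Y ≫ (M.obj a b ◁ N.lact b b' c) ▷ Y ≫ f b) :
    ∃ g : tensorObj M N a c ≫ Y ⟶ T, ∀ b, tι M N a b c ▷ Y ≫ g = f b :=
  tensor_desc M N a c (postcomp _ Y) f hf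

/-- The map out of the tensor product induced by a balanced family. -/
noncomputable def tdesc {a : A.ob} {c : C.ob} {T : A.ext a ⟶ C.ext c}
    (f : ∀ b, M.obj a b ≫ N.obj b c ⟶ T)
    (hf : ∀ b b', M.ract a b b' ▷ N.obj b' c ≫ f b' =
      (α_ _ _ _).hom ≫ M.obj a b ◁ N.lact b b' c ≫ f b) : tensorObj M N a c ⟶ T :=
  (exists_tdesc M N f hf).choose

theorem tι_tdesc {a : A.ob} {c : C.ob} {T : A.ext a ⟶ C.ext c}
    (f : ∀ b, M.obj a b ≫ N.obj b c ⟶ T) (hf) (b : B.ob) :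
    tι M N a b c ≫ tdesc M N f hf = f b :=
  (exists_tdesc M N f hf).choose_spec b

/-- The map out of the left-whiskered tensor product induced by a balanced family. -/
noncomputable def tdescL {a : A.ob} {c : C.ob} {x : W} (X : x ⟶ A.ext a) {T : x ⟶ C.ext c}
    (f : ∀ b, X ≫ M.obj a b ≫ N.obj b c ⟶ T)
    (hf : ∀ b b', X ◁ M.ract a b b' ▷ N.obj b' c ≫ f b' =
      X ◁ (α_ _ _ _).hom ≫ X ◁ M.obj a b ◁ N.lact b b' c ≫ f b) : X ≫ tensorObj M N a c ⟶ T :=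
  (exists_tdescL M N X f hf).choose

theorem tι_tdescL {a : A.ob} {c : C.ob} {x : W} (X : x ⟶ A.ext a) {T : x ⟶ C.ext c}
    (f : ∀ b, X ≫ M.obj a b ≫ N.obj b c ⟶ T) (hf) (b : B.ob) :
    X ◁ tι M N a b c ≫ tdescL M N X f hf = f b :=
  (exists_tdescL M N X f hf).choose_spec b

/-- The map out of the right-whiskered tensor product induced by a balanced family. -/
noncomputable def tdescR {a : A.ob} {c : C.ob} {y : W} (Y : C.ext c ⟶ y) {T : A.ext a ⟶ y}
    (f : ∀ b, (M.obj a b ≫ N.obj b c) ≫ Y ⟶ T)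
    (hf : ∀ b b', M.ract a b b' ▷ N.obj b' c ▷ Y ≫ f b' =
      (α_ _ _ _).hom ▷ Y ≫ (M.obj a b ◁ N.lact b b' c) ▷ Y ≫ f b) : tensorObj M N a c ≫ Y ⟶ T :=
  (exists_tdescR M N Y f hf).choose

theorem tι_tdescR {a : A.ob} {c : C.ob} {y : W} (Y : C.ext c ⟶ y) {T : A.ext a ⟶ y}
    (f : ∀ b, (M.obj a b ≫ N.obj b c) ≫ Y ⟶ T) (hf) (b : B.ob) :
    tι M N a b c ▷ Y ≫ tdescR M N Y f hf = f b :=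
  (exists_tdescR M N Y f hf).choose_spec b

variable {M N}

theorem t_ext {a : A.ob} {c : C.ob} {T : A.ext a ⟶ C.ext c} {g h : tensorObj M N a c ⟶ T}
    (H : ∀ b, tι M N a b c ≫ g = tι M N a b c ≫ h) : g = h :=
  tι_jointEpi M N a c g h H

theorem t_extL {a : A.ob} {c : C.ob} {x : W} {X : x ⟶ A.ext a} {T : x ⟶ C.ext c}
    {g h : X ≫ tensorObj M N a c ⟶ T}
    (H : ∀ b, X ◁ tι M N a b c ≫ g = X ◁ tι M N a b c ≫ h) : g = h :=
  (tι_jointEpi M N a c).map (precomp _ X) g h H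

theorem t_extR {a : A.ob} {c : C.ob} {y : W} {Y : C.ext c ⟶ y} {T : A.ext a ⟶ y}
    {g h : tensorObj M N a c ≫ Y ⟶ T}
    (H : ∀ b, tι M N a b c ▷ Y ≫ g = tι M N a b c ▷ Y ≫ h) : g = h :=
  (tι_jointEpi M N a c).map (postcomp _ Y) g h H

theorem t_extLR {a : A.ob} {c : C.ob} {x y : W} {X : x ⟶ A.ext a} {Y : C.ext c ⟶ y} {T : x ⟶ y}
    {g h : X ≫ tensorObj M N a c ≫ Y ⟶ T}
    (H : ∀ b, X ◁ tι M N a b c ▷ Y ≫ g = X ◁ tι M N a b c ▷ Y ≫ h) : g = h :=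
  ((tι_jointEpi M N a c).map (postcomp _ Y)).map (precomp _ X) g h H

variable (M N)

/-- The action of `A` on the tensor product, inherited from `M`. -/
noncomputable def tlact (a a' : A.ob) (c : C.ob) :
    A.hom a a' ≫ tensorObj M N a' c ⟶ tensorObj M N a c :=
  tdescL M N (A.hom a a') (fun b => (α_ _ _ _).inv ≫ M.lact a a' b ▷ N.obj b c ≫ tι M N a b c)
    (fun b b' => by
      have h2 : M.lact a a' b ▷ B.hom b b' ▷ N.obj b' c ≫ M.ract a b b' ▷ N.obj b' c =
          (α_ _ _ _).hom ▷ _ ≫ (A.hom a a' ◁ M.ract a' b b') ▷ _ ≫ M.lact a a' b' ▷ _ := by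
        rw [← comp_whiskerRight, M.lact_ract, comp_whiskerRight, comp_whiskerRight]
      have h3 := tι_balanced M N a b b' c
      rw [← whisker_assoc_symm_aux, Iso.inv_comp_eq,
        ← cancel_epi ((α_ (A.hom a a') (M.obj a' b) (B.hom b b')).hom ▷ N.obj b' c),
        ← reassoc_of% h2, h3, associator_naturality_left_assoc, ← whisker_exchange_assoc]
      simp)

theorem tι_tlact (a a' : A.ob) (b : B.ob) (c : C.ob) :
    A.hom a a' ◁ tι M N a' b c ≫ tlact M N a a' c =
      (α_ _ _ _).inv ≫ M.lact a a' b ▷ N.obj b c ≫ tι M N a b c :=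
  tι_tdescL M N _ _ _ b

/-- The action of `C` on the tensor product, inherited from `N`. -/
noncomputable def tract (a : A.ob) (c c' : C.ob) :
    tensorObj M N a c ≫ C.hom c c' ⟶ tensorObj M N a c' :=
  tdescR M N (C.hom c c') (fun b => (α_ _ _ _).hom ≫ M.obj a b ◁ N.ract b c c' ≫ tι M N a b c')
    (fun b b' => by
      have h2 := congrArg (M.obj a b ◁ ·) (N.lact_ract b b' c c')
      simp only [whiskerLeft_comp] at h2
      have h3 := tι_balanced M N a b b' c'
      rw [associator_naturality_left_assoc, ← whisker_exchange_assoc, h3]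
      simp [reassoc_of% h2])

theorem tι_tract (a : A.ob) (b : B.ob) (c c' : C.ob) :
    tι M N a b c ▷ C.hom c c' ≫ tract M N a c c' =
      (α_ _ _ _).hom ≫ M.obj a b ◁ N.ract b c c' ≫ tι M N a b c' :=
  tι_tdescR M N _ _ _ b

/-- The tensor product over `B` of the profunctors `M : A ⇸ B` and `N : B ⇸ C`. -/
noncomputable def tensor : WProf A C where
  obj := tensorObj M N
  lact := tlact M N
  ract := tract M N
  id_lact a c := t_extL fun b => by
    have h := congrArg (· ▷ N.obj b c) (M.id_lact a b)
    simp only [comp_whiskerRight] at h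
    rw [whisker_exchange_assoc, tι_tlact]
    simp [reassoc_of% h]
  comp_lact a a' a'' c := t_extL fun b => by
    have h := congrArg (· ▷ N.obj b c) (M.comp_lact a a' a'' b)
    simp only [comp_whiskerRight] at h
    rw [whisker_exchange_assoc, tι_tlact]
    have h1 := tι_tlact M N a a' b c
    have h2 := congrArg (A.hom a a' ◁ ·) (tι_tlact M N a' a'' b c)
    simp only [whiskerLeft_comp] at h2
    simp [reassoc_of% h, reassoc_of% h2, h1]
  ract_id a c := t_extR fun b => by
    have h := congrArg (M.obj a b ◁ ·) (N.ract_id b c)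
    simp only [whiskerLeft_comp] at h
    rw [← whisker_exchange_assoc, tι_tract]
    simp [reassoc_of% h]
  ract_ract a c c' c'' := by
    rw [← Iso.inv_comp_eq]
    refine t_extR fun b => ?_
    have h := congrArg (M.obj a b ◁ ·) (N.ract_ract b c c' c'')
    simp only [whiskerLeft_comp] at h
    have h1 : tι M N a b c ▷ C.hom c c' ▷ C.hom c' c'' ≫ tract M N a c c' ▷ C.hom c' c'' =
      (α_ _ _ _).hom ▷ _ ≫ (M.obj a b ◁ N.ract b c c') ▷ _ ≫ tι M N a b c' ▷ _ := by
      rw [← comp_whiskerRight, tι_tract, comp_whiskerRight, comp_whiskerRight]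
    have h2 := tι_tract M N a b c' c''
    rw [← whisker_exchange_assoc, tι_tract]
    simp [reassoc_of% h, reassoc_of% h1, h2]
  lact_ract a a' c c' := by
    rw [← Iso.inv_comp_eq]
    refine t_extLR fun b => ?_
    have h1 := tι_tract M N a b c c'
    have h2 := tι_tlact M N a a' b c'
    have h3 := congrArg (A.hom a a' ◁ ·) (tι_tract M N a' b c c')
    simp only [whiskerLeft_comp] at h3
    have h4 : (A.hom a a' ◁ tι M N a' b c) ▷ C.hom c c' ≫ tlact M N a a' c ▷ C.hom c c' =
      (α_ _ _ _).inv ▷ _ ≫ M.lact a a' b ▷ N.obj b c ▷ _ ≫ tι M N a b c ▷ _ := by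
      rw [← comp_whiskerRight, tι_tlact, comp_whiskerRight, comp_whiskerRight]
    rw [reassoc_of% h3, h2, ← whisker_assoc_symm_aux, reassoc_of% h4, h1,
      associator_naturality_left_assoc, ← whisker_exchange_assoc]
    simp

/-- The universal balanced family, with values in the tensor product. -/
noncomputable def ι (a : A.ob) (b : B.ob) (c : C.ob) :
    M.obj a b ≫ N.obj b c ⟶ (tensor M N).obj a c :=
  tι M N a b c

theorem ι_balanced (a : A.ob) (b b' : B.ob) (c : C.ob) :
    M.ract a b b' ▷ N.obj b' c ≫ ι M N a b' c =
      (α_ _ _ _).hom ≫ M.obj a b ◁ N.lact b b' c ≫ ι M N a b c :=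
  tι_balanced M N a b b' c

theorem ι_lact (a a' : A.ob) (b : B.ob) (c : C.ob) :
    A.hom a a' ◁ ι M N a' b c ≫ (tensor M N).lact a a' c =
      (α_ _ _ _).inv ≫ M.lact a a' b ▷ N.obj b c ≫ ι M N a b c :=
  tι_tlact M N a a' b c

theorem ι_ract (a : A.ob) (b : B.ob) (c c' : C.ob) :
    ι M N a b c ▷ C.hom c c' ≫ (tensor M N).ract a c c' =
      (α_ _ _ _).hom ≫ M.obj a b ◁ N.ract b c c' ≫ ι M N a b c' :=
  tι_tract M N a b c c'

/-- The map out of a component of the tensor product induced by a balanced family. -/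
noncomputable def desc {a : A.ob} {c : C.ob} {T : A.ext a ⟶ C.ext c}
    (f : ∀ b, M.obj a b ≫ N.obj b c ⟶ T)
    (hf : ∀ b b', M.ract a b b' ▷ N.obj b' c ≫ f b' =
      (α_ _ _ _).hom ≫ M.obj a b ◁ N.lact b b' c ≫ f b) : (tensor M N).obj a c ⟶ T :=
  tdesc M N f hf

theorem ι_desc {a : A.ob} {c : C.ob} {T : A.ext a ⟶ C.ext c}
    (f : ∀ b, M.obj a b ≫ N.obj b c ⟶ T) (hf) (b : B.ob) :
    ι M N a b c ≫ desc M N f hf = f b :=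
  tι_tdesc M N f hf b

/-- The map out of a left-whiskered component induced by a balanced family. -/
noncomputable def descL {a : A.ob} {c : C.ob} {x : W} (X : x ⟶ A.ext a) {T : x ⟶ C.ext c}
    (f : ∀ b, X ≫ M.obj a b ≫ N.obj b c ⟶ T)
    (hf : ∀ b b', X ◁ M.ract a b b' ▷ N.obj b' c ≫ f b' =
      X ◁ (α_ _ _ _).hom ≫ X ◁ M.obj a b ◁ N.lact b b' c ≫ f b) :
    X ≫ (tensor M N).obj a c ⟶ T :=
  tdescL M N X f hf

theorem ι_descL {a : A.ob} {c : C.ob} {x : W} (X : x ⟶ A.ext a) {T : x ⟶ C.ext c}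
    (f : ∀ b, X ≫ M.obj a b ≫ N.obj b c ⟶ T) (hf) (b : B.ob) :
    X ◁ ι M N a b c ≫ descL M N X f hf = f b :=
  tι_tdescL M N X f hf b

/-- The map out of a right-whiskered component induced by a balanced family. -/
noncomputable def descR {a : A.ob} {c : C.ob} {y : W} (Y : C.ext c ⟶ y) {T : A.ext a ⟶ y}
    (f : ∀ b, (M.obj a b ≫ N.obj b c) ≫ Y ⟶ T)
    (hf : ∀ b b', M.ract a b b' ▷ N.obj b' c ▷ Y ≫ f b' =
      (α_ _ _ _).hom ▷ Y ≫ (M.obj a b ◁ N.lact b b' c) ▷ Y ≫ f b) :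
    (tensor M N).obj a c ≫ Y ⟶ T :=
  tdescR M N Y f hf

theorem ι_descR {a : A.ob} {c : C.ob} {y : W} (Y : C.ext c ⟶ y) {T : A.ext a ⟶ y}
    (f : ∀ b, (M.obj a b ≫ N.obj b c) ≫ Y ⟶ T) (hf) (b : B.ob) :
    ι M N a b c ▷ Y ≫ descR M N Y f hf = f b :=
  tι_tdescR M N Y f hf b

variable {M N}

theorem ι_ext {a : A.ob} {c : C.ob} {T : A.ext a ⟶ C.ext c} {g h : (tensor M N).obj a c ⟶ T}
    (H : ∀ b, ι M N a b c ≫ g = ι M N a b c ≫ h) : g = h :=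
  tι_jointEpi M N a c g h H

theorem ι_extL {a : A.ob} {c : C.ob} {x : W} {X : x ⟶ A.ext a} {T : x ⟶ C.ext c}
    {g h : X ≫ (tensor M N).obj a c ⟶ T}
    (H : ∀ b, X ◁ ι M N a b c ≫ g = X ◁ ι M N a b c ≫ h) : g = h :=
  t_extL H

theorem ι_extR {a : A.ob} {c : C.ob} {y : W} {Y : C.ext c ⟶ y} {T : A.ext a ⟶ y}
    {g h : (tensor M N).obj a c ≫ Y ⟶ T}
    (H : ∀ b, ι M N a b c ▷ Y ≫ g = ι M N a b c ▷ Y ≫ h) : g = h :=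
  t_extR H

theorem ι_extLR {a : A.ob} {c : C.ob} {x y : W} {X : x ⟶ A.ext a} {Y : C.ext c ⟶ y} {T : x ⟶ y}
    {g h : X ≫ (tensor M N).obj a c ≫ Y ⟶ T}
    (H : ∀ b, X ◁ ι M N a b c ▷ Y ≫ g = X ◁ ι M N a b c ▷ Y ≫ h) : g = h :=
  t_extLR H

/-- The profunctor map out of a tensor product induced by a family of 2-cells that is balanced
over `B` and compatible with the outer actions. -/
noncomputable def tensorHom {L : WProf A C} (f : ∀ a b c, M.obj a b ≫ N.obj b c ⟶ L.obj a c)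
    (hf : ∀ a b b' c, M.ract a b b' ▷ N.obj b' c ≫ f a b' c =
      (α_ _ _ _).hom ≫ M.obj a b ◁ N.lact b b' c ≫ f a b c)
    (hl : ∀ a a' b c, M.lact a a' b ▷ N.obj b c ≫ f a b c =
      (α_ _ _ _).hom ≫ A.hom a a' ◁ f a' b c ≫ L.lact a a' c)
    (hr : ∀ a b c c', f a b c ▷ C.hom c c' ≫ L.ract a c c' =
      (α_ _ _ _).hom ≫ M.obj a b ◁ N.ract b c c' ≫ f a b c') : tensor M N ⟶ L where
  app a c := desc M N (fun b => f a b c) (fun b b' => hf a b b' c)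
  lact_app a a' c := ι_extL fun b => by
    have h1 := ι_desc M N (fun b => f a b c) (fun b b' => hf a b b' c) b
    have h2 := congrArg (A.hom a a' ◁ ·)
      (ι_desc M N (fun b => f a' b c) (fun b b' => hf a' b b' c) b)
    simp only [whiskerLeft_comp] at h2
    rw [reassoc_of% (ι_lact M N a a' b c), h1, reassoc_of% h2, hl, Iso.inv_hom_id_assoc]
  ract_app a c c' := ι_extR fun b => by
    have h1 := ι_desc M N (fun b => f a b c') (fun b b' => hf a b b' c') b
    have h2 := congrArg (· ▷ C.hom c c')
      (ι_desc M N (fun b => f a b c) (fun b b' => hf a b b' c) b)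
    simp only [comp_whiskerRight] at h2
    rw [reassoc_of% (ι_ract M N a b c c'), h1, reassoc_of% h2, hr]

theorem ι_tensorHom {L : WProf A C} (f : ∀ a b c, M.obj a b ≫ N.obj b c ⟶ L.obj a c)
    (hf hl hr) (a : A.ob) (b : B.ob) (c : C.ob) :
    ι M N a b c ≫ (tensorHom (L := L) f hf hl hr).app a c = f a b c :=
  ι_desc M N (fun b => f a b c) (fun b b' => hf a b b' c) b

theorem tensor_hom_ext {L : WProf A C} {f g : tensor M N ⟶ L}
    (h : ∀ a b c, ι M N a b c ≫ f.app a c = ι M N a b c ≫ g.app a c) : f = g :=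
  hom_ext fun a c => ι_ext fun b => h a b c

end Tensor

/-- A profunctor map with invertible components is invertible. -/
@[simps]
def isoMk {M N : WProf A B} (f : M ⟶ N) (g : ∀ a b, N.obj a b ⟶ M.obj a b)
    (h₁ : ∀ a b, f.app a b ≫ g a b = 𝟙 _) (h₂ : ∀ a b, g a b ≫ f.app a b = 𝟙 _) : M ≅ N where
  hom := f
  inv :=
    { app := g
      lact_app := fun a a' b => by
        have h : A.hom a a' ◁ g a' b ≫ A.hom a a' ◁ f.app a' b = 𝟙 _ := by
          rw [← whiskerLeft_comp, h₂, whiskerLeft_id]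
        rw [← Category.id_comp (N.lact a a' b), ← h, Category.assoc, Category.assoc,
          ← reassoc_of% (f.lact_app a a' b), h₁]
        simp
      ract_app := fun a b b' => by
        have h : g a b ▷ B.hom b b' ≫ f.app a b ▷ B.hom b b' = 𝟙 _ := by
          rw [← comp_whiskerRight, h₂, id_whiskerRight]
        rw [← Category.id_comp (N.ract a b b'), ← h, Category.assoc, Category.assoc,
          ← reassoc_of% (f.ract_app a b b'), h₁]
        simp }
  hom_inv_id := hom_ext h₁
  inv_hom_id := hom_ext h₂

section Whisker

/-- Left whiskering: the tensor product of the identity of `M` with `g`. -/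
noncomputable def whiskerL (M : WProf A B) {N N' : WProf B C} (g : N ⟶ N') :
    tensor M N ⟶ tensor M N' :=
  tensorHom (fun a b c => M.obj a b ◁ g.app b c ≫ ι M N' a b c)
    (fun a b b' c => by
      have h := congrArg (M.obj a b ◁ ·) (g.lact_app b b' c)
      simp only [whiskerLeft_comp] at h
      rw [reassoc_of% h, ← whisker_exchange_assoc, ι_balanced]
      simp)
    (fun a a' b c => by
      rw [← whisker_exchange_assoc]
      simp [ι_lact])
    (fun a b c c' => by
      have h := congrArg (M.obj a b ◁ ·) (g.ract_app b c c')
      simp only [whiskerLeft_comp] at h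
      simp [ι_ract, reassoc_of% h])

theorem ι_whiskerL (M : WProf A B) {N N' : WProf B C} (g : N ⟶ N') (a : A.ob) (b : B.ob)
    (c : C.ob) : ι M N a b c ≫ (whiskerL M g).app a c = M.obj a b ◁ g.app b c ≫ ι M N' a b c :=
  ι_tensorHom _ _ _ _ a b c

/-- Right whiskering: the tensor product of `f` with the identity of `N`. -/
noncomputable def whiskerR {M M' : WProf A B} (f : M ⟶ M') (N : WProf B C) :
    tensor M N ⟶ tensor M' N :=
  tensorHom (fun a b c => f.app a b ▷ N.obj b c ≫ ι M' N a b c)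
    (fun a b b' c => by
      have h := congrArg (· ▷ N.obj b' c) (f.ract_app a b b')
      simp only [comp_whiskerRight] at h
      rw [reassoc_of% h, whisker_exchange_assoc, ι_balanced]
      simp)
    (fun a a' b c => by
      have h := congrArg (· ▷ N.obj b c) (f.lact_app a a' b)
      simp only [comp_whiskerRight] at h
      simp [ι_lact, reassoc_of% h])
    (fun a b c c' => by
      rw [whisker_exchange_assoc]
      simp [ι_ract])

theorem ι_whiskerR {M M' : WProf A B} (f : M ⟶ M') (N : WProf B C) (a : A.ob) (b : B.ob)
    (c : C.ob) : ι M N a b c ≫ (whiskerR f N).app a c = f.app a b ▷ N.obj b c ≫ ι M' N a b c :=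
  ι_tensorHom _ _ _ _ a b c

end Whisker

section Unitors

variable (M : WProf A B)

/-- The left unitor as a map, induced by the action of `A`. -/
noncomputable def lUnitorHom : tensor (idProf A) M ⟶ M :=
  tensorHom (fun a a' b => M.lact a a' b) (fun a a' a'' b => M.comp_lact a a' a'' b)
    (fun a a' a'' b => M.comp_lact a a' a'' b) (fun a a' b b' => M.lact_ract a a' b b')

theorem ι_lUnitorHom (a a' : A.ob) (b : B.ob) :
    ι (idProf A) M a a' b ≫ (lUnitorHom M).app a b = M.lact a a' b :=
  ι_tensorHom (M := idProf A) (N := M) (L := M) (fun a a' b => M.lact a a' b)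
    (fun a a' a'' b => M.comp_lact a a' a'' b)
    (fun a a' a'' b => M.comp_lact a a' a'' b) (fun a a' b b' => M.lact_ract a a' b b') a a' b

/-- The left unitor. -/
noncomputable def lUnitor : tensor (idProf A) M ≅ M :=
  isoMk (lUnitorHom M)
    (fun a b => (λ_ _).inv ≫ A.id a ▷ M.obj a b ≫ ι (idProf A) M a a b)
    (fun a b => ι_ext fun a' => by
      have h := ι_balanced (idProf A) M a a a' b
      rw [← Iso.inv_comp_eq] at h
      rw [← Category.assoc, ι_lUnitorHom, leftUnitor_inv_naturality_assoc, whisker_exchange_assoc]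
      have h' := congrArg (· ▷ M.obj a' b) (A.id_comp a a')
      simp only [comp_whiskerRight] at h'
      rw [← h]
      simp [reassoc_of% h'])
    (fun a b => by
      rw [Category.assoc, Category.assoc, ι_lUnitorHom, M.id_lact, Iso.inv_hom_id])

theorem ι_lUnitor (a a' : A.ob) (b : B.ob) :
    ι (idProf A) M a a' b ≫ (lUnitor M).hom.app a b = M.lact a a' b :=
  ι_lUnitorHom M a a' b

/-- The right unitor as a map, induced by the action of `B`. -/
noncomputable def rUnitorHom : tensor M (idProf B) ⟶ M :=
  tensorHom (fun a b b' => M.ract a b b') (fun a b b' b'' => M.ract_ract a b b' b'')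
    (fun a a' b b' => M.lact_ract a a' b b') (fun a b b' b'' => M.ract_ract a b b' b'')

theorem ι_rUnitorHom (a : A.ob) (b b' : B.ob) :
    ι M (idProf B) a b b' ≫ (rUnitorHom M).app a b' = M.ract a b b' :=
  ι_tensorHom (M := M) (N := idProf B) (L := M) (fun a b b' => M.ract a b b')
    (fun a b b' b'' => M.ract_ract a b b' b'') (fun a a' b b' => M.lact_ract a a' b b')
    (fun a b b' b'' => M.ract_ract a b b' b'') a b b'

/-- The right unitor. -/
noncomputable def rUnitor : tensor M (idProf B) ≅ M :=
  isoMk (rUnitorHom M)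
    (fun a b => (ρ_ _).inv ≫ M.obj a b ◁ B.id b ≫ ι M (idProf B) a b b)
    (fun a b' => ι_ext fun b => by
      have h := ι_balanced M (idProf B) a b b' b'
      rw [← Category.assoc, ι_rUnitorHom, rightUnitor_inv_naturality_assoc, ← whisker_exchange_assoc]
      have h' := congrArg (M.obj a b ◁ ·) (B.comp_id b b')
      simp only [whiskerLeft_comp] at h'
      simp [h, reassoc_of% h'])
    (fun a b => by
      rw [Category.assoc, Category.assoc, ι_rUnitorHom, M.ract_id, Iso.inv_hom_id])

theorem ι_rUnitor (a : A.ob) (b b' : B.ob) :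
    ι M (idProf B) a b b' ≫ (rUnitor M).hom.app a b' = M.ract a b b' :=
  ι_rUnitorHom M a b b'

end Unitors

section Associator

variable (M : WProf A B) (N : WProf B C) (P : WProf C D)

/-- Auxiliary map for the associator. -/
noncomputable def assocAux (a : A.ob) (c : C.ob) (d : D.ob) :
    (tensor M N).obj a c ≫ P.obj c d ⟶ (tensor M (tensor N P)).obj a d :=
  descR M N (P.obj c d)
    (fun b => (α_ _ _ _).hom ≫ M.obj a b ◁ ι N P b c d ≫ ι M (tensor N P) a b d)
    (fun b b' => by
      have h := congrArg (M.obj a b ◁ ·) (ι_lact N P b b' c d)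
      simp only [whiskerLeft_comp] at h
      rw [associator_naturality_left_assoc, ← whisker_exchange_assoc, ι_balanced]
      simp [reassoc_of% h])

theorem ι_assocAux (a : A.ob) (b : B.ob) (c : C.ob) (d : D.ob) :
    ι M N a b c ▷ P.obj c d ≫ assocAux M N P a c d =
      (α_ _ _ _).hom ≫ M.obj a b ◁ ι N P b c d ≫ ι M (tensor N P) a b d :=
  ι_descR M N (P.obj c d) _ _ b

/-- The associator, as a map. -/
noncomputable def assocHom : tensor (tensor M N) P ⟶ tensor M (tensor N P) :=
  tensorHom (assocAux M N P)
    (fun a c c' d => by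
      rw [← Iso.inv_comp_eq]
      refine ι_extR fun b => ?_
      have h1 := congrArg (· ▷ P.obj c' d) (ι_ract M N a b c c')
      simp only [comp_whiskerRight] at h1
      have h2 := congrArg (M.obj a b ◁ ·) (ι_balanced N P b c c' d)
      simp only [whiskerLeft_comp] at h2
      have h3 := ι_assocAux M N P a b c d
      have h4 := ι_assocAux M N P a b c' d
      rw [← whisker_exchange_assoc, h3]
      simp [reassoc_of% h1, h4, reassoc_of% h2])
    (fun a a' c d => by
      rw [← Iso.inv_comp_eq]
      refine ι_extLR fun b => ?_
      have h1 := congrArg (· ▷ P.obj c d) (ι_lact M N a a' b c)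
      simp only [comp_whiskerRight] at h1
      have h2 := congrArg (A.hom a a' ◁ ·) (ι_assocAux M N P a' b c d)
      simp only [whiskerLeft_comp] at h2
      have h3 := ι_lact M (tensor N P) a a' b d
      have h4 := ι_assocAux M N P a b c d
      rw [← whisker_assoc_symm_aux, reassoc_of% h1, h4, reassoc_of% h2, h3,
        associator_naturality_left_assoc, ← whisker_exchange_assoc]
      simp)
    (fun a c d d' => by
      rw [← cancel_epi (α_ _ _ _).inv, Iso.inv_hom_id_assoc]
      refine ι_extR fun b => ?_
      have h1 := congrArg (· ▷ D.hom d d') (ι_assocAux M N P a b c d)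
      simp only [comp_whiskerRight] at h1
      have h2 := congrArg (M.obj a b ◁ ·) (ι_ract N P b c d d')
      simp only [whiskerLeft_comp] at h2
      have h3 := ι_ract M (tensor N P) a b d d'
      have h4 := ι_assocAux M N P a b c d'
      rw [← whisker_exchange_assoc, h4]
      simp [reassoc_of% h1, h3, reassoc_of% h2])

theorem ι_assocHom (a : A.ob) (c : C.ob) (d : D.ob) :
    ι (tensor M N) P a c d ≫ (assocHom M N P).app a d = assocAux M N P a c d :=
  ι_tensorHom _ _ _ _ a c d

theorem ι_ι_assocHom (a : A.ob) (b : B.ob) (c : C.ob) (d : D.ob) :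
    ι M N a b c ▷ P.obj c d ≫ ι (tensor M N) P a c d ≫ (assocHom M N P).app a d =
      (α_ _ _ _).hom ≫ M.obj a b ◁ ι N P b c d ≫ ι M (tensor N P) a b d := by
  rw [ι_assocHom, ι_assocAux]

/-- Auxiliary map for the inverse of the associator. -/
noncomputable def assocInvAux (a : A.ob) (b : B.ob) (d : D.ob) :
    M.obj a b ≫ (tensor N P).obj b d ⟶ (tensor (tensor M N) P).obj a d :=
  descL N P (M.obj a b)
    (fun c => (α_ _ _ _).inv ≫ ι M N a b c ▷ P.obj c d ≫ ι (tensor M N) P a c d)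
    (fun c c' => by
      have h1 := congrArg (· ▷ P.obj c' d) (ι_ract M N a b c c')
      simp only [comp_whiskerRight] at h1
      have h2 := ι_balanced (tensor M N) P a c c' d
      rw [← whisker_assoc_symm_aux, Iso.inv_comp_eq, ← cancel_epi ((α_ _ _ _).hom ▷ _),
        ← reassoc_of% h1, h2, associator_naturality_left_assoc, ← whisker_exchange_assoc]
      simp)

theorem ι_assocInvAux (a : A.ob) (b : B.ob) (c : C.ob) (d : D.ob) :
    M.obj a b ◁ ι N P b c d ≫ assocInvAux M N P a b d =
      (α_ _ _ _).inv ≫ ι M N a b c ▷ P.obj c d ≫ ι (tensor M N) P a c d :=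
  ι_descL N P (M.obj a b) _ _ c

/-- The components of the inverse of the associator. -/
noncomputable def assocInv (a : A.ob) (d : D.ob) :
    (tensor M (tensor N P)).obj a d ⟶ (tensor (tensor M N) P).obj a d :=
  desc M (tensor N P) (fun b => assocInvAux M N P a b d)
    (fun b b' => by
      refine ι_extL fun c => ?_
      have h1 := congrArg (M.obj a b ◁ ·) (ι_lact N P b b' c d)
      simp only [whiskerLeft_comp] at h1
      have h2 := congrArg (· ▷ P.obj c d) (ι_balanced M N a b b' c)
      simp only [comp_whiskerRight] at h2
      have h3 := ι_assocInvAux M N P a b c d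
      have h4 := ι_assocInvAux M N P a b' c d
      rw [whisker_exchange_assoc, h4]
      simp [reassoc_of% h1, h3, reassoc_of% h2])

theorem ι_assocInv (a : A.ob) (b : B.ob) (d : D.ob) :
    ι M (tensor N P) a b d ≫ assocInv M N P a d = assocInvAux M N P a b d :=
  ι_desc _ _ _ _ b

/-- The associator. -/
noncomputable def assocIso : tensor (tensor M N) P ≅ tensor M (tensor N P) :=
  isoMk (assocHom M N P) (assocInv M N P)
    (fun a d => ι_ext fun c => ι_extR fun b => by
      rw [reassoc_of% (ι_ι_assocHom M N P a b c d), ι_assocInv, ι_assocInvAux]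
      simp)
    (fun a d => ι_ext fun b => ι_extL fun c => by
      rw [reassoc_of% (ι_assocInv M N P a b d), reassoc_of% (ι_assocInvAux M N P a b c d),
        ι_ι_assocHom]
      simp)

end Associator

section Laws

theorem whiskerL_id (M : WProf A B) (N : WProf B C) : whiskerL M (𝟙 N) = 𝟙 (tensor M N) :=
  tensor_hom_ext fun a b c => by rw [ι_whiskerL]; simp

theorem whiskerL_comp (M : WProf A B) {N N' N'' : WProf B C} (f : N ⟶ N') (g : N' ⟶ N'') :
    whiskerL M (f ≫ g) = whiskerL M f ≫ whiskerL M g :=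
  tensor_hom_ext fun a b c => by
    rw [ι_whiskerL, comp_app, comp_app, reassoc_of% (ι_whiskerL M f a b c), ι_whiskerL]; simp

theorem whiskerR_id (M : WProf A B) (N : WProf B C) : whiskerR (𝟙 M) N = 𝟙 (tensor M N) :=
  tensor_hom_ext fun a b c => by rw [ι_whiskerR]; simp

theorem whiskerR_comp {M M' M'' : WProf A B} (f : M ⟶ M') (g : M' ⟶ M'') (N : WProf B C) :
    whiskerR (f ≫ g) N = whiskerR f N ≫ whiskerR g N :=
  tensor_hom_ext fun a b c => by
    rw [ι_whiskerR, comp_app, comp_app, reassoc_of% (ι_whiskerR f N a b c), ι_whiskerR]; simp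

theorem whisker_exch {M M' : WProf A B} {N N' : WProf B C} (f : M ⟶ M') (g : N ⟶ N') :
    whiskerL M g ≫ whiskerR f N' = whiskerR f N ≫ whiskerL M' g :=
  tensor_hom_ext fun a b c => by
    rw [comp_app, comp_app, reassoc_of% (ι_whiskerL M g a b c), ι_whiskerR,
      reassoc_of% (ι_whiskerR f N a b c), ι_whiskerL, whisker_exchange_assoc]

theorem id_whiskerL {M N : WProf A B} (f : M ⟶ N) :
    whiskerL (idProf A) f ≫ lUnitorHom N = lUnitorHom M ≫ f :=
  tensor_hom_ext fun a b c => by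
    rw [comp_app, comp_app, reassoc_of% (ι_whiskerL (idProf A) f a b c), ι_lUnitorHom,
      ← Category.assoc, ι_lUnitorHom, f.lact_app]

theorem id_whiskerR {M N : WProf A B} (f : M ⟶ N) :
    whiskerR f (idProf B) ≫ rUnitorHom N = rUnitorHom M ≫ f :=
  tensor_hom_ext fun a b c => by
    rw [comp_app, comp_app, reassoc_of% (ι_whiskerR f (idProf B) a b c), ι_rUnitorHom,
      ← Category.assoc, ι_rUnitorHom, f.ract_app]

theorem tensor_whiskerL (M : WProf A B) (N : WProf B C) {P P' : WProf C D} (f : P ⟶ P') :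
    whiskerL (tensor M N) f ≫ assocHom M N P' = assocHom M N P ≫ whiskerL M (whiskerL N f) :=
  tensor_hom_ext fun a c d => ι_extR fun b => by
    have h := congrArg (M.obj a b ◁ ·) (ι_whiskerL N f b c d)
    simp only [whiskerLeft_comp] at h
    rw [comp_app, comp_app, reassoc_of% (ι_whiskerL (tensor M N) f a c d),
      reassoc_of% (ι_ι_assocHom M N P a b c d), ι_whiskerL, reassoc_of% h,
      ← whisker_exchange_assoc, ι_ι_assocHom]
    simp

theorem whiskerR_tensor {M M' : WProf A B} (f : M ⟶ M') (N : WProf B C) (P : WProf C D) :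
    whiskerR (whiskerR f N) P ≫ assocHom M' N P = assocHom M N P ≫ whiskerR f (tensor N P) :=
  tensor_hom_ext fun a c d => ι_extR fun b => by
    have h := congrArg (· ▷ P.obj c d) (ι_whiskerR f N a b c)
    simp only [comp_whiskerRight] at h
    rw [comp_app, comp_app, reassoc_of% (ι_whiskerR (whiskerR f N) P a c d),
      reassoc_of% (ι_ι_assocHom M N P a b c d), ι_whiskerR, reassoc_of% h,
      ι_ι_assocHom, whisker_exchange_assoc]
    simp

theorem whisker_middle (M : WProf A B) {N N' : WProf B C} (f : N ⟶ N') (P : WProf C D) :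
    whiskerR (whiskerL M f) P ≫ assocHom M N' P = assocHom M N P ≫ whiskerL M (whiskerR f P) :=
  tensor_hom_ext fun a c d => ι_extR fun b => by
    have h := congrArg (· ▷ P.obj c d) (ι_whiskerL M f a b c)
    simp only [comp_whiskerRight] at h
    have h' := congrArg (M.obj a b ◁ ·) (ι_whiskerR f P b c d)
    simp only [whiskerLeft_comp] at h'
    rw [comp_app, comp_app, reassoc_of% (ι_whiskerR (whiskerL M f) P a c d),
      reassoc_of% (ι_ι_assocHom M N P a b c d), ι_whiskerL, reassoc_of% h, reassoc_of% h',
      ι_ι_assocHom]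
    simp

theorem assoc_triangle (M : WProf A B) (N : WProf B C) :
    assocHom M (idProf B) N ≫ whiskerL M (lUnitorHom N) = whiskerR (rUnitorHom M) N :=
  tensor_hom_ext fun a b' c => ι_extR fun b => by
    have h := congrArg (· ▷ N.obj b' c) (ι_rUnitorHom M a b b')
    simp only [comp_whiskerRight] at h
    have h' := congrArg (M.obj a b ◁ ·) (ι_lUnitorHom N b b' c)
    simp only [whiskerLeft_comp] at h'
    rw [comp_app, reassoc_of% (ι_ι_assocHom M (idProf B) N a b b' c), ι_whiskerL,
      reassoc_of% h', ι_whiskerR, reassoc_of% h, ι_balanced]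

theorem assoc_pentagon (M : WProf A B) (N : WProf B C) (P : WProf C D) (Q : WProf D E) :
    whiskerR (assocHom M N P) Q ≫ assocHom M (tensor N P) Q ≫ whiskerL M (assocHom N P Q) =
      assocHom (tensor M N) P Q ≫ assocHom M N (tensor P Q) :=
  tensor_hom_ext fun a d e => ι_extR fun c => by
    rw [← cancel_epi (α_ _ _ _).inv]
    refine ι_extR fun b => ?_
    have h1 := congrArg (· ▷ Q.obj d e) (ι_ι_assocHom M N P a b c d)
    simp only [comp_whiskerRight] at h1
    have h2 := congrArg (M.obj a b ◁ ·) (ι_ι_assocHom N P Q b c d e)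
    simp only [whiskerLeft_comp] at h2
    have h3 := ι_ι_assocHom M (tensor N P) Q a b d e
    have h4 := ι_ι_assocHom (tensor M N) P Q a c d e
    have h5 := ι_ι_assocHom M N (tensor P Q) a b c e
    simp only [comp_app]
    rw [reassoc_of% h4, Iso.inv_hom_id_assoc, ← whisker_exchange_assoc, h5,
      reassoc_of% (ι_whiskerR (assocHom M N P) Q a d e),
      associator_inv_naturality_left_assoc, reassoc_of% h1, reassoc_of% h3, ι_whiskerL,
      ← Category.assoc ((M.obj a b ◁ ι N P b c d) ▷ Q.obj d e)]
    simp [reassoc_of% h2]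

end Laws

end WProf

/-- The bicategory of small `W`-categories, profunctors and profunctor maps. The composite
`M ≫ N` of `M : A ⇸ B` and `N : B ⇸ C` is the tensor product of `M` and `N` over `B`. -/
noncomputable instance WMod.bicategory (W : Type u) [Bicategory.{w, v} W] [BiclosedBicategory W] :
    Bicategory.{w, max w v} (WMod W) where
  Hom A B := WProf A B
  id A := WProf.idProf A
  comp M N := WProf.tensor M N
  homCategory A B := WProf.category A B
  whiskerLeft M _ _ g := WProf.whiskerL M g
  whiskerRight f N := WProf.whiskerR f N
  associator M N P := WProf.assocIso M N P
  leftUnitor M := WProf.lUnitor M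
  rightUnitor M := WProf.rUnitor M
  whiskerLeft_id M N := WProf.whiskerL_id M N
  whiskerLeft_comp M _ _ _ f g := WProf.whiskerL_comp M f g
  id_whiskerLeft {_ _ _ N} f := by
    rw [← Category.assoc, Iso.eq_comp_inv]
    exact WProf.id_whiskerL f
  comp_whiskerLeft M N _ P' f := by
    rw [← Category.assoc, Iso.eq_comp_inv]
    exact WProf.tensor_whiskerL M N f
  id_whiskerRight M N := WProf.whiskerR_id M N
  comp_whiskerRight f g N := WProf.whiskerR_comp f g N
  whiskerRight_id f := by
    rw [← Category.assoc, Iso.eq_comp_inv]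
    exact WProf.id_whiskerR f
  whiskerRight_comp f N P := by
    rw [Iso.eq_inv_comp]
    exact (WProf.whiskerR_tensor f N P).symm
  whisker_assoc M _ _ f P := by
    rw [← Category.assoc, Iso.eq_comp_inv]
    exact WProf.whisker_middle M f P
  whisker_exchange f g := WProf.whisker_exch f g
  pentagon M N P Q := WProf.assoc_pentagon M N P Q
  triangle M N := WProf.assoc_triangle M N

namespace WCat

section Fibres

variable {W : Type u} [Bicategory.{w, v} W] (C : WCat.{w, v, u, u₁} W)

/-- The objects of `C` of extent `x`. -/
def Fib (x : W) : Type u₁ := {c : C.ob // C.ext c = x}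

/-- The hom-objects of `C`, between objects of prescribed extents. -/
def fhom : {x y : W} → C.Fib x → C.Fib y → (x ⟶ y)
  | _, _, ⟨c, rfl⟩, ⟨d, rfl⟩ => C.hom c d

/-- The identities of `C`, on an object of prescribed extent. -/
def fid : {x : W} → (c : C.Fib x) → (𝟙 x ⟶ C.fhom c c)
  | _, ⟨c, rfl⟩ => C.id c

/-- The composition of `C`, between objects of prescribed extents. -/
def fcomp : {x y z : W} → (c : C.Fib x) → (d : C.Fib y) → (e : C.Fib z) →
    (C.fhom c d ≫ C.fhom d e ⟶ C.fhom c e)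
  | _, _, _, ⟨c, rfl⟩, ⟨d, rfl⟩, ⟨e, rfl⟩ => C.comp c d e

theorem fid_comp {x y : W} (c : C.Fib x) (d : C.Fib y) :
    C.fid c ▷ C.fhom c d ≫ C.fcomp c c d = (λ_ (C.fhom c d)).hom := by
  obtain ⟨c, rfl⟩ := c
  obtain ⟨d, rfl⟩ := d
  exact C.id_comp c d

theorem fcomp_id {x y : W} (c : C.Fib x) (d : C.Fib y) :
    C.fhom c d ◁ C.fid d ≫ C.fcomp c d d = (ρ_ (C.fhom c d)).hom := by
  obtain ⟨c, rfl⟩ := c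
  obtain ⟨d, rfl⟩ := d
  exact C.comp_id c d

theorem fassoc {x y z t : W} (c : C.Fib x) (d : C.Fib y) (e : C.Fib z) (f : C.Fib t) :
    C.fcomp c d e ▷ C.fhom e f ≫ C.fcomp c e f =
      (α_ _ _ _).hom ≫ C.fhom c d ◁ C.fcomp d e f ≫ C.fcomp c d f := by
  obtain ⟨c, rfl⟩ := c
  obtain ⟨d, rfl⟩ := d
  obtain ⟨e, rfl⟩ := e
  obtain ⟨f, rfl⟩ := f
  exact C.assoc c d e f

end Fibres

/-- The small `W`-category with one object, of extent `x`, and hom-object the identity of `x`. -/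
def unit {W : Type u} [Bicategory.{w, v} W] (x : W) : WMod W where
  ob := PUnit
  ext _ := x
  hom _ _ := 𝟙 x
  id _ := 𝟙 (𝟙 x)
  comp _ _ _ := (λ_ (𝟙 x)).hom
  id_comp _ _ := by simp
  comp_id _ _ := by simp [unitors_equal]
  assoc _ _ _ _ := by simp [unitors_equal]

end WCat

/-- A `W`-functor from `A` to `C`: an extent-preserving assignment on objects with an action on
hom-objects that respects identities and composition. -/
structure WFunctor {W : Type u} [Bicategory.{w, v} W] (A : WCat.{w, v, u, u₁} W)
    (C : WCat.{w, v, u, u₂} W) where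
  obj : ∀ a : A.ob, C.Fib (A.ext a)
  map : ∀ a b, A.hom a b ⟶ C.fhom (obj a) (obj b)
  map_id : ∀ a, A.id a ≫ map a a = C.fid (obj a)
  map_comp : ∀ a b c, A.comp a b c ≫ map a c =
    map a b ▷ A.hom b c ≫ C.fhom (obj a) (obj b) ◁ map b c ≫ C.fcomp (obj a) (obj b) (obj c)

namespace WFunctor

variable {W : Type u} [Bicategory.{w, v} W] {A B D : WMod W} {C : WCat.{w, v, u, u₁} W}

/-- An object of `C` of extent `x`, as a functor from the one-object category on `x`. -/
def pt {x : W} (c : C.Fib x) : WFunctor (WCat.unit x) C where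
  obj _ := c
  map _ _ := C.fid c
  map_id _ := by
    change 𝟙 (𝟙 x) ≫ C.fid c = C.fid c
    simp
  map_comp _ _ _ := by
    change (λ_ (𝟙 x)).hom ≫ C.fid c = C.fid c ▷ 𝟙 x ≫ C.fhom c c ◁ C.fid c ≫ C.fcomp c c c
    rw [C.fcomp_id, rightUnitor_naturality, unitors_equal]

/-- An object `c` of `C`, as a functor from the one-object category on the extent of `c`. -/
abbrev ofOb (C : WCat.{w, v, u, u₁} W) (c : C.ob) : WFunctor (WCat.unit (C.ext c)) C :=
  pt ⟨c, rfl⟩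

/-- The profunctor `C(G, F) : A ⇸ B` of functors `F : A → C` and `G : B → C`, with components
`C(G b, F a)`. -/
def homProf (G : WFunctor B C) (F : WFunctor A C) : WProf A B where
  obj a b := C.fhom (F.obj a) (G.obj b)
  lact a a' b := F.map a a' ▷ C.fhom (F.obj a') (G.obj b) ≫ C.fcomp _ _ _
  ract a b b' := C.fhom (F.obj a) (G.obj b) ◁ G.map b b' ≫ C.fcomp _ _ _
  id_lact a b := by
    rw [← Category.assoc, ← comp_whiskerRight, F.map_id, C.fid_comp]
  comp_lact a a' a'' b := by
    rw [← Category.assoc, ← comp_whiskerRight, F.map_comp]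
    have h := C.fassoc (F.obj a) (F.obj a') (F.obj a'') (G.obj b)
    simp only [comp_whiskerRight, Category.assoc, h, whiskerLeft_comp]
    rw [whisker_exchange_assoc, whisker_exchange_assoc]
    simp
  ract_id a b := by
    rw [← Category.assoc, ← whiskerLeft_comp, G.map_id, C.fcomp_id]
  ract_ract a b b' b'' := by
    have h := C.fassoc (F.obj a) (G.obj b) (G.obj b') (G.obj b'')
    rw [← Category.assoc (C.fhom (F.obj a) (G.obj b) ◁ B.comp b b' b''), ← whiskerLeft_comp,
      G.map_comp, comp_whiskerRight, Category.assoc, ← whisker_exchange_assoc, h]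
    simp
  lact_ract a a' b b' := by
    have h := C.fassoc (F.obj a) (F.obj a') (G.obj b) (G.obj b')
    rw [comp_whiskerRight, Category.assoc, ← whisker_exchange_assoc, h, whiskerLeft_comp,
      Category.assoc, whisker_exchange_assoc, whisker_exchange_assoc]
    simp

/-- The action of `Z` on hom-objects, as a profunctor map `A → C(Z, Z)`. -/
def homMap (Z : WFunctor A C) : WProf.idProf A ⟶ homProf Z Z where
  app a b := Z.map a b
  lact_app a a' b := by
    dsimp [homProf]
    rw [Z.map_comp, whisker_exchange_assoc]
  ract_app a b b' := Z.map_comp a b b'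

variable [BiclosedBicategory W]

/-- Composition in `C`, as a profunctor map `C(F, Z) ⊗_A C(Z, G) → C(F, G)`. -/
noncomputable def homComp (F : WFunctor B C) (Z : WFunctor A C) (G : WFunctor D C) :
    WProf.tensor (homProf Z G) (homProf F Z) ⟶ homProf F G :=
  WProf.tensorHom (fun d a b => C.fcomp (G.obj d) (Z.obj a) (F.obj b))
    (fun d a a' b => by
      have h := C.fassoc (G.obj d) (Z.obj a) (Z.obj a') (F.obj b)
      dsimp [homProf]
      simp [h])
    (fun d d' a b => by
      have h := C.fassoc (G.obj d) (G.obj d') (Z.obj a) (F.obj b)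
      dsimp [homProf]
      rw [whisker_exchange_assoc]
      simp [h])
    (fun d a b b' => by
      have h := C.fassoc (G.obj d) (Z.obj a) (F.obj b) (F.obj b')
      dsimp [homProf]
      rw [← whisker_exchange_assoc, h]
      simp)

end WFunctor

section Weighted

variable {W : Type u} [Bicategory.{w, v} W] [BiclosedBicategory W]

/-- `u : N ⊗_B M → L` exhibits `M` as `[N, L]`: every `f : N ⊗_B K → L` is `u ∘ (N ⊗_B g)` for a
unique `g : K → M`. -/
def ExhibitsRightLift {A B C : WMod W} {M : A ⟶ B} {N : B ⟶ C} {L : A ⟶ C}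
    (u : M ≫ N ⟶ L) : Prop :=
  ∀ (K : A ⟶ B) (f : K ≫ N ⟶ L), ∃! g : K ⟶ M, g ▷ N ≫ u = f

/-- `u : N ⊗_B M → L` exhibits `N` as `⟨M, L⟩`: every `f : K ⊗_B M → L` is `u ∘ (g ⊗_B M)` for a
unique `g : K → N`. -/
def ExhibitsRightExtension {A B C : WMod W} {M : A ⟶ B} {N : B ⟶ C} {L : A ⟶ C}
    (u : M ≫ N ⟶ L) : Prop :=
  ∀ (K : B ⟶ C) (f : M ≫ K ⟶ L), ∃! g : K ⟶ N, M ◁ g ≫ u = f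

variable {A B D : WMod W} {C : WCat.{w, v, u, u₁} W}

/-- The profunctor `C(G, F) : A ⇸ B`, as a 1-cell of the bicategory of modules. -/
abbrev WFunctor.hom (G : WFunctor B C) (F : WFunctor A C) : A ⟶ B := WFunctor.homProf G F

/-- Composition in `C`, as a 2-cell `C(F, Z) ⊗_A C(Z, G) → C(F, G)` of modules. -/
noncomputable abbrev WFunctor.μ (F : WFunctor B C) (Z : WFunctor A C) (G : WFunctor D C) :
    Z.hom G ≫ F.hom Z ⟶ F.hom G := WFunctor.homComp F Z G

/-- The effect of `Z` on homs, as a 2-cell `A → C(Z, Z)` of modules. -/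
abbrev WFunctor.onHom (Z : WFunctor A C) : 𝟙 A ⟶ Z.hom Z := WFunctor.homMap Z

/-- `a : φ → C(F, Z)` exhibits `Z` as a `φ`-weighted colimit of `F`: for each object `c` of `C`,
`φ ⊗_A C(Z, c) → C(F, Z) ⊗_A C(Z, c) → C(F, c)` exhibits `C(Z, c)` as `[φ, C(F, c)]`. -/
def IsWeightedColimit (φ : A ⟶ B) (F : WFunctor B C) (Z : WFunctor A C) (a : φ ⟶ F.hom Z) : Prop :=
  ∀ c : C.ob, ExhibitsRightLift
    (Z.hom (WFunctor.ofOb C c) ◁ a ≫ WFunctor.μ F Z (WFunctor.ofOb C c))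

/-- `b : ψ → C(Z, F)` exhibits `Z` as a `ψ`-weighted limit of `F`: for each object `c` of `C`,
`C(c, Z) ⊗_A ψ → C(c, Z) ⊗_A C(Z, F) → C(c, F)` exhibits `C(c, Z)` as `⟨ψ, C(c, F)⟩`. -/
def IsWeightedLimit (ψ : B ⟶ A) (F : WFunctor B C) (Z : WFunctor A C) (b : ψ ⟶ Z.hom F) : Prop :=
  ∀ c : C.ob, ExhibitsRightExtension
    (b ▷ (WFunctor.ofOb C c).hom Z ≫ WFunctor.μ (WFunctor.ofOb C c) Z F)

/-- Commutativity of the two squares: the composite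
`A → ψ ⊗_B φ → C(Z, F) ⊗_B C(F, Z) → C(Z, Z)` is the effect of `Z` on homs, and
`φ ⊗_A ψ → C(F, Z) ⊗_A C(Z, F) → C(F, F)` is the counit followed by the effect of `F` on homs. -/
structure AbsoluteSquares {φ : A ⟶ B} {ψ : B ⟶ A} (adj : Bicategory.Adjunction φ ψ)
    (F : WFunctor B C) (Z : WFunctor A C) (a : φ ⟶ F.hom Z) (b : ψ ⟶ Z.hom F) : Prop where
  unit_square : adj.unit ≫ (a ▷ ψ ≫ F.hom Z ◁ b) ≫ WFunctor.μ Z F Z = Z.onHom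
  counit_square : (b ▷ φ ≫ Z.hom F ◁ a) ≫ WFunctor.μ F Z F = adj.counit ≫ F.onHom

end Weighted

/-! The argument is a Yoneda-style one. Since `φ ⊣ ψ`, composing with `ψ` already computes the right
lift `[φ, L]` as `L ≫ ψ`, in diagrammatic order. So `a` is a colimit cocone exactly when, for each
object `c`, the transpose of the map in the definition is an isomorphism from `C(Z, c)` to `ψ ⊗ C(F,
c)`. The components of this transpose are insensitive to the domain of a functor `G` into `C`. Hence
it is equivalent to ask that the comparison `w_G : C(Z, G) → ψ ⊗ C(F, G)`, which is `colimitMate`,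
be invertible for every `G` with small domain, in particular for `G = F` and `G = Z`
(`isWeightedColimit_iff`).

A map `b` induces `v_G : ψ ⊗ C(F, G) → C(Z, G)` in the other direction. By associativity of `μ`,
going along `w_G` and then `v_G` is composition with the left side of the unit square, while going
along `v_G` and then `w_G` is the transpose of composition with the left side of the counit square.
The two squares therefore make `w_G` and `v_G` mutually inverse, and the data (c) yield a colimit.

Conversely, let all `w_G` be invertible. The counit square is equivalent to an equation prescribing
`b` followed by `w_F` (`comp_colimitMate_eq_iff`), so exactly one `b` satisfies it. For that `b`,
`v_Z` is a one-sided inverse of the invertible `w_Z`, hence its inverse. Evaluating `w_Z` at the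
identities of `Z` (`onHom_colimitMate`) then gives the unit square.

The limit half is the mirror image: extensions replace lifts, `homEquiv₁` replaces `homEquiv₂`, and
the same two squares appear. -/

/-! ### Naturality of transposition along an adjunction in a bicategory. -/

namespace CategoryTheory.Bicategory.Adjunction

variable {𝔹 : Type u} [Bicategory.{w, v} 𝔹] {a b d : 𝔹} {l : a ⟶ b} {r : b ⟶ a}
  (adj : Bicategory.Adjunction l r)

theorem homEquiv₂_naturality_left {g g' : d ⟶ a} {h : d ⟶ b} (f : g ⟶ g') (k : g' ≫ l ⟶ h) :
    adj.homEquiv₂ (f ▷ l ≫ k) = f ≫ adj.homEquiv₂ k := by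
  simp only [homEquiv₂_apply, comp_whiskerRight]
  rw [rightUnitor_inv_naturality_assoc, ← whisker_exchange_assoc]
  simp

theorem homEquiv₁_symm_naturality_left {g g' : a ⟶ d} {h : b ⟶ d} (f : g ⟶ g')
    (k : r ≫ g' ⟶ h) : adj.homEquiv₁.symm (r ◁ f ≫ k) = f ≫ adj.homEquiv₁.symm k := by
  simp only [homEquiv₁_symm_apply, whiskerLeft_comp]
  rw [leftUnitor_inv_naturality_assoc, whisker_exchange_assoc]
  simp

end CategoryTheory.Bicategory.Adjunction

/-! ### Associativity and unit laws for composition in `C`, as equations between module maps. -/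

namespace WFunctor

variable {W : Type u} [Bicategory.{w, v} W] [BiclosedBicategory W]
  {A B D E : WMod W} {C : WCat.{w, v, u, u₁} W}

theorem ι_homComp (F : WFunctor B C) (Z : WFunctor A C) (G : WFunctor D C) (d a b) :
    WProf.ι (homProf Z G) (homProf F Z) d a b ≫ WProfHom.app (homComp F Z G) d b =
      C.fcomp (G.obj d) (Z.obj a) (F.obj b) :=
  WProf.ι_tensorHom _ _ _ _ d a b

theorem homComp_assoc (H : WFunctor E C) (F : WFunctor B C) (Z : WFunctor A C)
    (G : WFunctor D C) :
    WProf.whiskerR (homComp F Z G) (homProf H F) ≫ homComp H F G =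
      WProf.assocHom (homProf Z G) (homProf F Z) (homProf H F) ≫
        WProf.whiskerL (homProf Z G) (homComp H F Z) ≫ homComp H Z G := by
  refine WProf.tensor_hom_ext fun d b e => WProf.ι_extR fun a => ?_
  simp only [WProf.comp_app]
  rw [reassoc_of% WProf.ι_whiskerR, reassoc_of% WProf.ι_ι_assocHom,
    reassoc_of% WProf.ι_whiskerL, ← comp_whiskerRight_assoc,
    ← whiskerLeft_comp_assoc, ι_homComp, ι_homComp, ι_homComp, ι_homComp]
  exact C.fassoc _ _ _ _

/-- `homComp_assoc` read in the bicategory of modules, where the general coherence and exchange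
lemmas apply. All later computations use only this law and the two unit laws `onHom_μ` and
`μ_onHom`. -/
theorem μ_assoc (H : WFunctor E C) (F : WFunctor B C) (Z : WFunctor A C) (G : WFunctor D C) :
    μ F Z G ▷ H.hom F ≫ μ H F G =
      (α_ (Z.hom G) (F.hom Z) (H.hom F)).hom ≫ Z.hom G ◁ μ H F Z ≫ μ H Z G :=
  homComp_assoc H F Z G

/-- The action of `D` on `C(F, G)` is by definition "apply `G` on homs, then compose in `C`", so on
each coprojection the two sides coincide definitionally. -/
theorem homMap_homComp (F : WFunctor B C) (G : WFunctor D C) :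
    WProf.whiskerR (homMap G) (homProf F G) ≫ homComp F G G =
      WProf.lUnitorHom (homProf F G) := by
  refine WProf.tensor_hom_ext fun d d' b => ?_
  rw [WProf.comp_app, reassoc_of% WProf.ι_whiskerR, WProf.ι_lUnitorHom, ι_homComp]
  rfl

theorem homComp_homMap (Z : WFunctor A C) (G : WFunctor D C) :
    WProf.whiskerL (homProf Z G) (homMap Z) ≫ homComp Z Z G =
      WProf.rUnitorHom (homProf Z G) := by
  refine WProf.tensor_hom_ext fun d a a' => ?_
  rw [WProf.comp_app, reassoc_of% WProf.ι_whiskerL, WProf.ι_rUnitorHom, ι_homComp]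
  rfl

theorem onHom_μ (F : WFunctor B C) (G : WFunctor D C) :
    G.onHom ▷ F.hom G ≫ μ F G G = (λ_ (F.hom G)).hom :=
  homMap_homComp F G

theorem μ_onHom (Z : WFunctor A C) (G : WFunctor D C) :
    Z.hom G ◁ Z.onHom ≫ μ Z Z G = (ρ_ (Z.hom G)).hom :=
  homComp_homMap Z G

end WFunctor

/-! ### Lifts and extensions along an adjoint, tested by invertibility of a transpose. -/

section Exhibits

variable {W : Type u} [Bicategory.{w, v} W] [BiclosedBicategory W] {A B D : WMod W}
  {φ : A ⟶ B} {ψ : B ⟶ A}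

/-- By naturality of transposition, factoring `f` through `k` is the same as factoring the transpose
of `f` through the transpose of `k`. Unique factorisation of every map into `L ≫ ψ` through a fixed
map says that this map is invertible. -/
theorem exhibitsRightLift_iff_isIso (adj : Bicategory.Adjunction φ ψ) {M : D ⟶ A} {L : D ⟶ B}
    (k : M ≫ φ ⟶ L) : ExhibitsRightLift k ↔ IsIso (adj.homEquiv₂ k) := by
  constructor
  · intro h
    -- Factoring the map whose transpose is the identity gives a section of the transpose of `k`.
    -- That it is also a retraction follows from uniqueness of the factorisation of `k` through
    -- itself.
    obtain ⟨g, hg, -⟩ := h _ (adj.homEquiv₂.symm (𝟙 (L ≫ ψ)))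
    have h₁ : g ≫ adj.homEquiv₂ k = 𝟙 _ := by
      rw [← adj.homEquiv₂_naturality_left, hg, Equiv.apply_symm_apply]
    refine ⟨g, (h M k).unique ?_ (by simp), h₁⟩
    apply adj.homEquiv₂.injective
    rw [adj.homEquiv₂_naturality_left, Category.assoc, h₁, Category.comp_id]
  · intro h K f
    refine ⟨adj.homEquiv₂ f ≫ inv (adj.homEquiv₂ k), adj.homEquiv₂.injective ?_, fun g hg => ?_⟩
    · rw [adj.homEquiv₂_naturality_left, Category.assoc, IsIso.inv_hom_id, Category.comp_id]
    · rw [IsIso.eq_comp_inv, ← adj.homEquiv₂_naturality_left, hg]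

theorem exhibitsRightExtension_iff_isIso (adj : Bicategory.Adjunction φ ψ) {N : A ⟶ D}
    {L : B ⟶ D} (k : ψ ≫ N ⟶ L) :
    ExhibitsRightExtension k ↔ IsIso (adj.homEquiv₁.symm k) := by
  constructor
  · intro h
    obtain ⟨g, hg, -⟩ := h _ (adj.homEquiv₁ (𝟙 (φ ≫ L)))
    have h₁ : g ≫ adj.homEquiv₁.symm k = 𝟙 _ := by
      rw [← adj.homEquiv₁_symm_naturality_left, hg, Equiv.symm_apply_apply]
    refine ⟨g, (h N k).unique ?_ (by simp), h₁⟩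
    apply adj.homEquiv₁.symm.injective
    rw [adj.homEquiv₁_symm_naturality_left, Category.assoc, h₁, Category.comp_id]
  · intro h K f
    refine ⟨adj.homEquiv₁.symm f ≫ inv (adj.homEquiv₁.symm k),
      adj.homEquiv₁.symm.injective ?_, fun g hg => ?_⟩
    · rw [adj.homEquiv₁_symm_naturality_left, Category.assoc, IsIso.inv_hom_id, Category.comp_id]
    · rw [IsIso.eq_comp_inv, ← adj.homEquiv₁_symm_naturality_left, hg]

end Exhibits

/-! ### Componentwise invertibility of module maps. -/

namespace WProf

variable {W : Type u} [Bicategory.{w, v} W] [BiclosedBicategory W] {A B : WMod W}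

theorem isIso_of_app {M N : A ⟶ B} (f : M ⟶ N) (h : ∀ a b, IsIso (WProfHom.app f a b)) :
    IsIso f :=
  (WProf.isoMk f (fun a b => inv (WProfHom.app f a b)) (fun _ _ => IsIso.hom_inv_id _)
    (fun _ _ => IsIso.inv_hom_id _)).isIso_hom

theorem isIso_app {M N : A ⟶ B} (f : M ⟶ N) [IsIso f] (a b) : IsIso (WProfHom.app f a b) :=
  ⟨WProfHom.app (inv f) a b, congrArg (fun g => WProfHom.app g a b) (IsIso.hom_inv_id f),
    congrArg (fun g => WProfHom.app g a b) (IsIso.inv_hom_id f)⟩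

end WProf

/-! ### The comparison maps and their composites with the maps induced by the other datum. -/

namespace WFunctor

variable {W : Type u} [Bicategory.{w, v} W] [BiclosedBicategory W]
  {A B D : WMod W} {C : WCat.{w, v, u, u₁} W}
  {φ : A ⟶ B} {ψ : B ⟶ A} (adj : Bicategory.Adjunction φ ψ)
  {F : WFunctor B C} {Z : WFunctor A C}

/-- The comparison `C(Z, G) → ψ ⊗_B C(F, G)` induced by `a : φ → C(F, Z)` and `φ ⊣ ψ`. -/
noncomputable def colimitMate (a : φ ⟶ F.hom Z) (G : WFunctor D C) : Z.hom G ⟶ F.hom G ≫ ψ :=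
  adj.homEquiv₂ (Z.hom G ◁ a ≫ μ F Z G)

/-- The comparison `C(G, Z) → C(G, F) ⊗_B φ` induced by `b : ψ → C(Z, F)` and `φ ⊣ ψ`. -/
noncomputable def limitMate (b : ψ ⟶ Z.hom F) (G : WFunctor D C) : G.hom Z ⟶ φ ≫ G.hom F :=
  adj.homEquiv₁.symm (b ▷ G.hom Z ≫ μ G Z F)

/-- True by definition: tensoring and transposing on the `A`, `B` side keep the index `d` fixed, so
neither the homs of `D` nor the action of `G` on them enter the component. -/
theorem colimitMate_app (a : φ ⟶ F.hom Z) (G : WFunctor D C) (d : D.ob) (x : A.ob) :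
    WProfHom.app (colimitMate adj a G) d x =
      WProfHom.app (colimitMate adj a (pt (G.obj d))) PUnit.unit x :=
  rfl

theorem limitMate_app (b : ψ ⟶ Z.hom F) (G : WFunctor D C) (x : A.ob) (d : D.ob) :
    WProfHom.app (limitMate adj b G) x d =
      WProfHom.app (limitMate adj b (pt (G.obj d))) x PUnit.unit :=
  rfl

/-- The definition tests only single objects of `C`. Passing to arbitrary `G` makes the comparison
available at `F` and `Z` themselves, where the converse direction needs it. -/
theorem isWeightedColimit_iff (a : φ ⟶ F.hom Z) :
    IsWeightedColimit φ F Z a ↔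
      ∀ (D : WMod W) (G : WFunctor D C), IsIso (colimitMate adj a G) := by
  refine ⟨fun h D G => WProf.isIso_of_app _ fun d x => ?_,
    fun h c => (exhibitsRightLift_iff_isIso adj _).2 (h _ (ofOb C c))⟩
  have key : ∀ {y : W} (c : C.Fib y), IsIso (colimitMate adj a (pt c)) := by
    -- An object of prescribed extent becomes an object with its own extent, which is the form
    -- `ofOb` in the definition.
    rintro _ ⟨c, rfl⟩
    exact (exhibitsRightLift_iff_isIso adj _).1 (h c)
  have := key (G.obj d)
  rw [colimitMate_app]
  exact WProf.isIso_app _ _ _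

theorem isWeightedLimit_iff (b : ψ ⟶ Z.hom F) :
    IsWeightedLimit ψ F Z b ↔
      ∀ (D : WMod W) (G : WFunctor D C), IsIso (limitMate adj b G) := by
  refine ⟨fun h D G => WProf.isIso_of_app _ fun x d => ?_,
    fun h c => (exhibitsRightExtension_iff_isIso adj _).2 (h _ (ofOb C c))⟩
  have key : ∀ {y : W} (c : C.Fib y), IsIso (limitMate adj b (pt c)) := by
    rintro _ ⟨c, rfl⟩
    exact (exhibitsRightExtension_iff_isIso adj _).1 (h c)
  have := key (G.obj d)
  rw [limitMate_app]
  exact WProf.isIso_app _ _ _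

/-- Interchange moves `b` past the composition in `C` used by `a`; `μ_assoc` then collects `a` and
`b` into the left side of the unit square. -/
theorem colimitMate_comp (a : φ ⟶ F.hom Z) (b : ψ ⟶ Z.hom F) (G : WFunctor D C) :
    colimitMate adj a G ≫ F.hom G ◁ b ≫ μ Z F G =
      (ρ_ (Z.hom G)).inv ≫ Z.hom G ◁ (adj.unit ≫ (a ▷ ψ ≫ F.hom Z ◁ b) ≫ μ Z F Z) ≫
        μ Z Z G := by
  simp only [colimitMate, Adjunction.homEquiv₂_apply, comp_whiskerRight, Category.assoc]
  rw [← whisker_exchange_assoc, μ_assoc]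
  simp

/-- The left side here is the transpose of the opposite composite, the map induced by `b` followed
by `colimitMate`. It isolates the left side of the counit square. -/
theorem comp_whiskerRight_comp (a : φ ⟶ F.hom Z) (b : ψ ⟶ Z.hom F) (G : WFunctor D C) :
    (F.hom G ◁ b ≫ μ Z F G) ▷ φ ≫ Z.hom G ◁ a ≫ μ F Z G =
      (α_ _ _ _).hom ≫ F.hom G ◁ ((b ▷ φ ≫ Z.hom F ◁ a) ≫ μ F Z F) ≫ μ F F G := by
  rw [comp_whiskerRight, Category.assoc, ← whisker_exchange_assoc, μ_assoc]
  simp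

theorem limitMate_comp (a : φ ⟶ F.hom Z) (b : ψ ⟶ Z.hom F) (G : WFunctor D C) :
    limitMate adj b G ≫ a ▷ G.hom F ≫ μ G F Z =
      (λ_ (G.hom Z)).inv ≫ (adj.unit ≫ (a ▷ ψ ≫ F.hom Z ◁ b) ≫ μ Z F Z) ▷ G.hom Z ≫
        μ G Z Z := by
  simp only [limitMate, Adjunction.homEquiv₁_symm_apply, comp_whiskerRight, Category.assoc, μ_assoc]
  simp only [whiskerLeft_comp, Category.assoc]
  rw [whisker_exchange_assoc, whisker_exchange_assoc]
  simp

theorem comp_whiskerLeft_comp (a : φ ⟶ F.hom Z) (b : ψ ⟶ Z.hom F) (G : WFunctor D C) :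
    ψ ◁ (a ▷ G.hom F ≫ μ G F Z) ≫ b ▷ G.hom Z ≫ μ G Z F =
      (α_ _ _ _).inv ≫ ((b ▷ φ ≫ Z.hom F ◁ a) ≫ μ F Z F) ▷ G.hom F ≫ μ G F F := by
  simp only [comp_whiskerRight, Category.assoc, μ_assoc, whiskerLeft_comp]
  rw [whisker_exchange_assoc, whisker_exchange_assoc]
  simp

end WFunctor

/-! ### What each of the two squares says about the comparison maps. -/

namespace WFunctor

variable {W : Type u} [Bicategory.{w, v} W] [BiclosedBicategory W]
  {A B D : WMod W} {C : WCat.{w, v, u, u₁} W}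
  {φ : A ⟶ B} {ψ : B ⟶ A} (adj : Bicategory.Adjunction φ ψ)
  {F : WFunctor B C} {Z : WFunctor A C} {a : φ ⟶ F.hom Z} {b : ψ ⟶ Z.hom F}

/-- After transposition the counit square leaves only the whiskered counit of `φ ⊣ ψ`, which is the
transpose of the identity. -/
theorem comp_colimitMate_of_counit_square
    (h : (b ▷ φ ≫ Z.hom F ◁ a) ≫ μ F Z F = adj.counit ≫ F.onHom) (G : WFunctor D C) :
    (F.hom G ◁ b ≫ μ Z F G) ≫ colimitMate adj a G = 𝟙 (F.hom G ≫ ψ) := by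
  apply adj.homEquiv₂.symm.injective
  rw [colimitMate, ← adj.homEquiv₂_naturality_left, Equiv.symm_apply_apply,
    comp_whiskerRight_comp, h, whiskerLeft_comp, Category.assoc, μ_onHom,
    Adjunction.homEquiv₂_symm_apply, id_whiskerRight, Category.id_comp]

theorem colimitMate_comp_of_unit_square
    (h : adj.unit ≫ (a ▷ ψ ≫ F.hom Z ◁ b) ≫ μ Z F Z = Z.onHom) (G : WFunctor D C) :
    colimitMate adj a G ≫ F.hom G ◁ b ≫ μ Z F G = 𝟙 (Z.hom G) := by
  rw [colimitMate_comp, h, μ_onHom, Iso.inv_hom_id]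

theorem comp_limitMate_of_counit_square
    (h : (b ▷ φ ≫ Z.hom F ◁ a) ≫ μ F Z F = adj.counit ≫ F.onHom) (G : WFunctor D C) :
    (a ▷ G.hom F ≫ μ G F Z) ≫ limitMate adj b G = 𝟙 (φ ≫ G.hom F) := by
  apply adj.homEquiv₁.injective
  rw [limitMate, ← adj.homEquiv₁_symm_naturality_left, Equiv.apply_symm_apply,
    comp_whiskerLeft_comp, h, comp_whiskerRight, Category.assoc, onHom_μ,
    Adjunction.homEquiv₁_apply, whiskerLeft_id, Category.id_comp]

theorem limitMate_comp_of_unit_square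
    (h : adj.unit ≫ (a ▷ ψ ≫ F.hom Z ◁ b) ≫ μ Z F Z = Z.onHom) (G : WFunctor D C) :
    limitMate adj b G ≫ a ▷ G.hom F ≫ μ G F Z = 𝟙 (G.hom Z) := by
  rw [limitMate_comp, h, onHom_μ, Iso.inv_hom_id]

/-- The Yoneda step: evaluated on the identities of `Z`, the comparison returns the transpose of
`a`. This is how the unit square is reached from invertibility. -/
theorem onHom_colimitMate (a : φ ⟶ F.hom Z) :
    Z.onHom ≫ colimitMate adj a Z = adj.unit ≫ a ▷ ψ := by
  rw [colimitMate, ← adj.homEquiv₂_naturality_left, ← whisker_exchange_assoc, onHom_μ,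
    Adjunction.homEquiv₂_apply]
  simp

theorem onHom_limitMate (b : ψ ⟶ Z.hom F) :
    Z.onHom ≫ limitMate adj b Z = adj.unit ≫ φ ◁ b := by
  rw [limitMate, ← adj.homEquiv₁_symm_naturality_left, whisker_exchange_assoc, μ_onHom,
    Adjunction.homEquiv₁_symm_apply]
  simp [unitors_inv_equal]

/-- Both sides are transposes of each other, `F.onHom ▷ ψ` corresponding to the counit followed by
`F.onHom`. With the comparison at `F` invertible, the counit square becomes an equation solvable
uniquely for `b`. -/
theorem comp_colimitMate_eq_iff :
    b ≫ colimitMate adj a F = (λ_ ψ).inv ≫ F.onHom ▷ ψ ↔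
      (b ▷ φ ≫ Z.hom F ◁ a) ≫ μ F Z F = adj.counit ≫ F.onHom := by
  have h : adj.homEquiv₂.symm ((λ_ ψ).inv ≫ F.onHom ▷ ψ) = adj.counit ≫ F.onHom := by
    rw [Adjunction.homEquiv₂_symm_apply, comp_whiskerRight, Category.assoc,
      associator_naturality_left_assoc, ← whisker_exchange_assoc]
    simp
  rw [colimitMate, ← adj.homEquiv₂_naturality_left, ← Equiv.eq_symm_apply, h, Category.assoc]

theorem comp_limitMate_eq_iff :
    a ≫ limitMate adj b F = (ρ_ φ).inv ≫ φ ◁ F.onHom ↔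
      (b ▷ φ ≫ Z.hom F ◁ a) ≫ μ F Z F = adj.counit ≫ F.onHom := by
  have h : adj.homEquiv₁ ((ρ_ φ).inv ≫ φ ◁ F.onHom) = adj.counit ≫ F.onHom := by
    rw [Adjunction.homEquiv₁_apply, whiskerLeft_comp, Category.assoc,
      associator_inv_naturality_right_assoc, whisker_exchange_assoc]
    simp [unitors_equal]
  rw [limitMate, ← adj.homEquiv₁_symm_naturality_left, Equiv.symm_apply_eq, h,
    whisker_exchange_assoc, Category.assoc]

end WFunctor

/-! ### From the squares to the universal properties, and uniqueness of the partner. -/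

namespace AbsoluteSquares

open WFunctor

variable {W : Type u} [Bicategory.{w, v} W] [BiclosedBicategory W]
  {A B : WMod W} {C : WCat.{w, v, u, u₁} W}
  {φ : A ⟶ B} {ψ : B ⟶ A} {adj : Bicategory.Adjunction φ ψ}
  {F : WFunctor B C} {Z : WFunctor A C} {a : φ ⟶ F.hom Z} {b : ψ ⟶ Z.hom F}

theorem isWeightedColimit (h : AbsoluteSquares adj F Z a b) : IsWeightedColimit φ F Z a :=
  (isWeightedColimit_iff adj a).2 fun _ G =>
    ⟨_, colimitMate_comp_of_unit_square adj h.unit_square G,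
      comp_colimitMate_of_counit_square adj h.counit_square G⟩

theorem isWeightedLimit (h : AbsoluteSquares adj F Z a b) : IsWeightedLimit ψ F Z b :=
  (isWeightedLimit_iff adj b).2 fun _ G =>
    ⟨_, limitMate_comp_of_unit_square adj h.unit_square G,
      comp_limitMate_of_counit_square adj h.counit_square G⟩

/-- The counit square fixes the composite of `b` with the comparison at `F`, which can be cancelled
because the squares make it invertible. -/
theorem right_unique {b' : ψ ⟶ Z.hom F} (h : AbsoluteSquares adj F Z a b)
    (h' : AbsoluteSquares adj F Z a b') : b = b' := by
  have := (isWeightedColimit_iff adj a).1 h.isWeightedColimit B F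
  rw [← cancel_mono (colimitMate adj a F), (comp_colimitMate_eq_iff adj).2 h.counit_square,
    (comp_colimitMate_eq_iff adj).2 h'.counit_square]

theorem left_unique {a' : φ ⟶ F.hom Z} (h : AbsoluteSquares adj F Z a b)
    (h' : AbsoluteSquares adj F Z a' b) : a = a' := by
  have := (isWeightedLimit_iff adj b).1 h.isWeightedLimit B F
  rw [← cancel_mono (limitMate adj b F), (comp_limitMate_eq_iff adj).2 h.counit_square,
    (comp_limitMate_eq_iff adj).2 h'.counit_square]

end AbsoluteSquares

/-! ### Constructing the partner from one universal property. -/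

section Existence

open WFunctor

variable {W : Type u} [Bicategory.{w, v} W] [BiclosedBicategory W]
  {A B : WMod W} {C : WCat.{w, v, u, u₁} W}
  {φ : A ⟶ B} {ψ : B ⟶ A} (adj : Bicategory.Adjunction φ ψ)
  {F : WFunctor B C} {Z : WFunctor A C} {a : φ ⟶ F.hom Z} {b : ψ ⟶ Z.hom F}

theorem IsWeightedColimit.exists_absoluteSquares (h : IsWeightedColimit φ F Z a) :
    ∃ b, AbsoluteSquares adj F Z a b := by
  rw [isWeightedColimit_iff adj] at h
  have hF := h B F
  have hZ := h A Z
  -- The only candidate: the solution of the equation in `comp_colimitMate_eq_iff`.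
  let b : ψ ⟶ Z.hom F := (λ_ ψ).inv ≫ F.onHom ▷ ψ ≫ inv (colimitMate adj a F)
  have hb : (b ▷ φ ≫ Z.hom F ◁ a) ≫ μ F Z F = adj.counit ≫ F.onHom :=
    (comp_colimitMate_eq_iff adj).1 (by simp [b])
  refine ⟨b, ?_, hb⟩
  -- The counit square alone gives a one-sided inverse; the comparison at `Z` is already invertible,
  -- so it is the inverse.
  have hv : F.hom Z ◁ b ≫ μ Z F Z = inv (colimitMate adj a Z) :=
    IsIso.eq_inv_of_inv_hom_id (comp_colimitMate_of_counit_square adj hb Z)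
  rw [Category.assoc, hv, ← Category.assoc, ← onHom_colimitMate, Category.assoc,
    IsIso.hom_inv_id, Category.comp_id]

theorem IsWeightedLimit.exists_absoluteSquares (h : IsWeightedLimit ψ F Z b) :
    ∃ a, AbsoluteSquares adj F Z a b := by
  rw [isWeightedLimit_iff adj] at h
  have hF := h B F
  have hZ := h A Z
  let a : φ ⟶ F.hom Z := (ρ_ φ).inv ≫ φ ◁ F.onHom ≫ inv (limitMate adj b F)
  have ha : (b ▷ φ ≫ Z.hom F ◁ a) ≫ μ F Z F = adj.counit ≫ F.onHom :=
    (comp_limitMate_eq_iff adj).1 (by simp [a])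
  refine ⟨a, ?_, ha⟩
  have hv : a ▷ Z.hom F ≫ μ Z F Z = inv (limitMate adj b Z) :=
    IsIso.eq_inv_of_inv_hom_id (comp_limitMate_of_counit_square adj ha Z)
  -- Interchange puts `b` before `a` in the unit square, so that the transposed `b` of
  -- `onHom_limitMate` appears next to the unit.
  rw [← whisker_exchange, Category.assoc, hv, ← Category.assoc, ← onHom_limitMate,
    Category.assoc, IsIso.hom_inv_id, Category.comp_id]

end Existence

theorem theorem1 {W : Type u} [Bicategory.{w, v} W] [BiclosedBicategory W]
    {A B : WMod W} {C : WCat.{w, v, u, u₁} W} {φ : A ⟶ B} {ψ : B ⟶ A}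
    (adj : Bicategory.Adjunction φ ψ) (F : WFunctor B C) (Z : WFunctor A C) :
    Set.BijOn Prod.fst
        {p : (φ ⟶ F.hom Z) × (ψ ⟶ Z.hom F) | AbsoluteSquares adj F Z p.1 p.2}
        {a : φ ⟶ F.hom Z | IsWeightedColimit φ F Z a} ∧
      Set.BijOn Prod.snd
        {p : (φ ⟶ F.hom Z) × (ψ ⟶ Z.hom F) | AbsoluteSquares adj F Z p.1 p.2}
        {b : ψ ⟶ Z.hom F | IsWeightedLimit ψ F Z b} := by
  refine ⟨⟨fun p hp => hp.isWeightedColimit, ?_, fun a ha => ?_⟩,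
    ⟨fun p hp => hp.isWeightedLimit, ?_, fun b hb => ?_⟩⟩
  · rintro ⟨a, b⟩ h ⟨_, b'⟩ h' rfl
    exact congrArg (Prod.mk a) (h.right_unique h')
  · obtain ⟨b, h⟩ := ha.exists_absoluteSquares adj
    exact ⟨(a, b), h, rfl⟩
  · rintro ⟨a, b⟩ h ⟨a', _⟩ h' rfl
    exact congrArg (Prod.mk · b) (h.left_unique h')
  · obtain ⟨a, h⟩ := hb.exists_absoluteSquares adj
    exact ⟨(a, b), h, rfl⟩
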